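/- Let $G$ be a finite group, $H<G$ a subgroup, $NH$ its normalizer and $W\!H=NH/H$. All spaces are compactly generated weak Hausdorff, products and mapping spaces being taken in the compactly generated sense; a $G$-space is a space with a continuous $G$-action; $X^H$ carries its $W\!H$-action, and base points are $G$-fixed. Modules are discrete unless called topological. A *topological abelian group* is an abelian group object in compactly generated spaces; a *topological $W\!H$-module* is one with an action of $W\!H$ by continuous automorphisms. Let $G\mathcal F$ be the category of finite $G$-sets. A *Mackey functor* $M$ consists of abelian groups $M(S)$, $S\in G\mathcal F$, with a covariant functoriality $f_*=M_*(f)$ and a contravariant one $f^*=M^*(f)$ that agree on objects, such that $M_*$ and $M^*$ turn finite disjoint unions into direct sums and, for every pullback square $h\circ f=k\circ g$ of finite $G$-sets ($f\colon A\to B$, $g\colon A\to C$, $h\colon B\to D$, $k\colon C\to D$), $h^*k_*=f_*g^*$. A *topological Mackey functor* has topological abelian groups as values and continuous $f_*,f^*$; its morphisms are families of continuous homomorphisms that commute with all $f_*$ and $f^*$. For a $W\!H$-module $A$ let $\mathcal RA$ be the Mackey functor $\mathcal RA(S)=\mathrm{Hom}_{W\!H}(S^H,A)$, where, for $f\colon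 S\to T$, $f^*\phi=\phi\circ f^H$ and $(f_*\psi)(t)=\sum_{s\in (f^H)^{-1}(t)}\psi(s)$. For a topological $W\!H$-module $B$ the same formulas define a topological Mackey functor $\mathcal RB$ with $\mathcal RB(S)=\mathrm{Map}_{W\!H}(S^H,B)$. For a $G$-space $X$ and a Mackey functor $M$ let $X\otimes_{G\mathcal F}M$ be the coend $$\Big(\coprod_{S\in G\mathcal F}\mathrm{Map}_G(S,X)\times M(S)\Big)\Big/\big((\varphi\circ f,\kappa)\approx(\varphi,f_*\kappa)\big)$$ with the quotient topology ($M(S)$ discrete) and the addition $[\varphi,\kappa]+[\psi,\mu]=[\varphi\sqcup\psi,\kappa\oplus\mu]$. The topological Mackey functor $X\otimes M$ is given by $(X\otimes M)(S)=(X\times S)\otimes_{G\mathcal F}M$; for $f\colon S\to T$, $f_*$ is induced by $\mathrm{id}_X\times f$, and $f^*[\gamma,c]=[\beta,F^*c]$ for $\gamma\colon C\to X\times T$, $c\in M(C)$, where $\beta\colon C\times_TS\to X\times S$ and $F\colon C\times_TS\to C$ are the projections of the pullback of $\gamma$ along $\mathrm{id}_X\times f$. For a $W\!H$-space $Y$ and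 a $W\!H$-module $A$ let $Y\otimes_{\mathcal F}A$ be the topological $W\!H$-module which, as a topological abelian group, is the analogous coend over the category $\mathcal F$ of finite sets of $S\mapsto\mathrm{Map}(S,Y)$ and $S\mapsto\mathrm{Hom}(S,A)$, the latter covariant by summation over fibres, and on which $W\!H$ acts diagonally through $Y$ and $A$. If $X$ has a base point $x_0$ (and $Y$ a base point $y_0$), put $$X\widetilde\otimes M=\mathrm{coker}(x_0\otimes M\to X\otimes M),\qquad Y\widetilde\otimes_{\mathcal F}A=\mathrm{coker}(y_0\otimes_{\mathcal F}A\to Y\otimes_{\mathcal F}A),$$ with the quotient topologies. **Proposition.** (1) There is an isomorphism of topological Mackey functors $$\varrho\colon X\otimes\mathcal RA\xrightarrow{\ \cong\ }\mathcal R(X^H\otimes_{\mathcal F}A),$$ natural in the $G$-space $X$ and the $W\!H$-module $A$. (2) There is an isomorphism of topological Mackey functors $$\widetilde\varrho\colon X\widetilde\otimes\mathcal RA\xrightarrow{\ \cong\ }\mathcal R(X^H\widetilde\otimes_{\mathcal F}A),$$ natural in the based $G$-space $X$ and the $W\!H$-module $A$, and $\varrho$, $\widetilde\varrho$ can be chosen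 so that $\widetilde\varrho$ is induced by $\varrho$: for $X$ based, the composite $X\otimes\mathcal RA\to X\widetilde\otimes\mathcal RA\xrightarrow{\widetilde\varrho}\mathcal R(X^H\widetilde\otimes_{\mathcal F}A)$ equals $X\otimes\mathcal RA\xrightarrow{\varrho}\mathcal R(X^H\otimes_{\mathcal F}A)\to\mathcal R(X^H\widetilde\otimes_{\mathcal F}A)$, the unnamed arrows being the projections. -/

import Mathlib

open CategoryTheory Topology

universe u v w

namespace MackeyTensor

noncomputable section

/-! ### Compactly generated weak Hausdorff spaces -/

/-- The family of all compact Hausdorff spaces in `Type u`. -/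
abbrev test (K : CompHaus.{u}) : Type u := K

/-- `Y` is compactly generated: its topology is the finest one for which all continuous maps from
compact Hausdorff spaces (in `Type u`) to `Y` are continuous. -/
abbrev CG (Y : Type v) [TopologicalSpace Y] : Prop := IsGeneratedBy test.{u} Y

/-- `Y` is weak Hausdorff: the image of each compact Hausdorff space is closed. -/
class WeakHausdorff (Y : Type v) [TopologicalSpace Y] : Prop where
  isClosed_range : ∀ (K : CompHaus.{u}) (f : C(K, Y)), IsClosed (Set.range f)

/-- `f` is continuous for the compactly generated topology on its source. For a source `Y × Z`, this
is continuity on the product in the category of compactly generated spaces. -/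
abbrev KContinuous {Y : Type v} {Z : Type w} [TopologicalSpace Y] [TopologicalSpace Z]
    (f : Y → Z) : Prop := ContinuousGeneratedBy test.{u} f

/-- The compactly generated refinement of a topology. -/
abbrev kify {Y : Type v} (t : TopologicalSpace Y) : TopologicalSpace Y :=
  @TopologicalSpace.generatedBy _ test.{u} _ Y t

theorem cg_iff_uCompactlyGeneratedSpace (Y : Type v) [TopologicalSpace Y] :
    CG.{u} Y ↔ UCompactlyGeneratedSpace.{u} Y := by
  constructor
  · intro h
    exact uCompactlyGeneratedSpace_of_isClosed fun s hs =>
      (IsGeneratedBy.isClosed_iff (X := test.{u})).2 fun K f => hs K f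
  · intro h
    rw [CG, IsGeneratedBy.iff_le_generatedBy]
    intro s hs
    refine UCompactlyGeneratedSpace.isOpen.{u} fun K f => ?_
    exact WithGeneratedByTopology.isOpen_iff.1 hs f

instance (i j : CompHaus.{u}) : IsGeneratedBy test.{u} (test i × test j) :=
  inferInstanceAs (IsGeneratedBy test.{u} (test (CompHaus.of (i × j))))

theorem locallyCompact_of_compactHausdorff (K : Type u) [TopologicalSpace K] [CompactSpace K]
    [T2Space K] : LocallyCompactSpace K := inferInstance

instance (i : CompHaus.{u}) : LocallyCompactSpace (test i) :=
  locallyCompact_of_compactHausdorff (i : Type u)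

theorem cg_kify {Y : Type v} (t : TopologicalSpace Y) : @CG.{u} Y (kify.{u} t) :=
  inferInstanceAs (IsGeneratedBy test.{u} (WithGeneratedByTopology test.{u} Y))

theorem continuous_kify {Y : Type v} {Z : Type w} {t : TopologicalSpace Y} {t' : TopologicalSpace Z}
    {f : Y → Z} (hf : Continuous[t, t'] f) : Continuous[kify.{u} t, t'] f :=
  continuous_le_dom TopologicalSpace.generatedBy_le hf

theorem continuous_kify_rng {Z : Type w} [TopologicalSpace Z] [CG.{u} Z] {Y : Type v}
    {t : TopologicalSpace Y} {f : Z → Y} (hf : Continuous f) :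
    @Continuous Z Y _ (kify.{u} t) f :=
  (IsGeneratedBy.equiv_symm_comp_continuous_iff (X := test.{u}) f).2 hf

theorem continuous_of_kContinuous {Y : Type v} {Z : Type w} [TopologicalSpace Y]
    [TopologicalSpace Z] [CG.{u} Y] {f : Y → Z} (hf : KContinuous.{u} f) : Continuous f :=
  (IsGeneratedBy.continuous_iff test.{u} f).2 hf

theorem cg_of_discrete {Y : Type v} [TopologicalSpace Y] [DiscreteTopology Y] : CG.{u} Y :=
  ⟨continuous_of_discreteTopology⟩

section Quotients

variable {Y Z T W : Type*} [TopologicalSpace Y] [TopologicalSpace Z] [TopologicalSpace T]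
  [TopologicalSpace W]

theorem kContinuous_of_quotient_right [CG.{u} Z] {q : Z → Y} (hq : IsQuotientMap q)
    {m : W × Y → T} (hm : KContinuous.{u} fun p : W × Z => m (p.1, q p.2)) :
    KContinuous.{u} m := by
  let g : ContinuousMapGeneratedBy test.{u} (W × Z) T := ⟨_, hm⟩
  let c := ContinuousMapGeneratedBy.curryEquiv g
  have hy : ∀ y, KContinuous.{u} fun x => m (x, y) := by
    intro y
    obtain ⟨z, rfl⟩ := hq.surjective y
    exact (c z).prop
  let h : Y → ContinuousMapGeneratedBy test.{u} W T := fun y => ⟨_, hy y⟩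
  have hc : Continuous h := by
    rw [hq.continuous_iff]
    exact continuous_of_kContinuous.{u} c.prop
  exact (ContinuousMapGeneratedBy.curryEquiv.symm
    (⟨h, hc.continuousGeneratedBy⟩ :
      ContinuousMapGeneratedBy test.{u} Y (ContinuousMapGeneratedBy test.{u} W T))).prop

theorem kContinuous_of_quotient [CG.{u} Z] {q : Z → Y} (hq : IsQuotientMap q)
    {m : Y × Y → T} (hm : KContinuous.{u} fun p : Z × Z => m (q p.1, q p.2)) :
    KContinuous.{u} m := by
  have h1 : KContinuous.{u} fun p : Y × Z => m (q p.2, p.1) := by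
    have h0 := kContinuous_of_quotient_right (m := fun p : Z × Y => m (q p.1, p.2)) hq hm
    exact h0.comp (f := Prod.swap) continuous_swap.continuousGeneratedBy
  have h2 := kContinuous_of_quotient_right (m := fun p : Y × Y => m (p.2, p.1)) hq h1
  exact h2.comp (f := Prod.swap) continuous_swap.continuousGeneratedBy

theorem kContinuous_of_sigma_quotient_right {ι : Type*} {Z : ι → Type*}
    [∀ i, TopologicalSpace (Z i)] [∀ i, CG.{u} (Z i)] {q : (Σ i, Z i) → Y} (hq : IsQuotientMap q)
    {m : W × Y → T} (hm : ∀ i, KContinuous.{u} fun p : W × Z i => m (p.1, q ⟨i, p.2⟩)) :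
    KContinuous.{u} m := by
  refine kContinuous_of_quotient_right hq ?_
  let h : (Σ i, Z i) → ContinuousMapGeneratedBy test.{u} W T := fun z =>
    ⟨_, (hm z.1).comp (f := fun w : W => (w, z.2))
      (Continuous.prodMk_left z.2).continuousGeneratedBy⟩
  have hc : Continuous h := by
    refine continuous_sigma fun i => ?_
    exact continuous_of_kContinuous.{u} (ContinuousMapGeneratedBy.curryEquiv
      (⟨_, hm i⟩ : ContinuousMapGeneratedBy test.{u} (W × Z i) T)).prop
  exact (ContinuousMapGeneratedBy.curryEquiv.symm
    (⟨h, hc.continuousGeneratedBy⟩ : ContinuousMapGeneratedBy test.{u} (Σ i, Z i)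
      (ContinuousMapGeneratedBy test.{u} W T))).prop

theorem kContinuous_of_sigma_quotient {ι : Type*} {Z : ι → Type*}
    [∀ i, TopologicalSpace (Z i)] [∀ i, CG.{u} (Z i)] {q : (Σ i, Z i) → Y} (hq : IsQuotientMap q)
    {m : Y × Y → T}
    (hm : ∀ i j, KContinuous.{u} fun p : Z i × Z j => m (q ⟨i, p.1⟩, q ⟨j, p.2⟩)) :
    KContinuous.{u} m := by
  refine kContinuous_of_sigma_quotient_right hq fun j => ?_
  have h1 := kContinuous_of_sigma_quotient_right
    (m := fun p : Z j × Y => m (p.2, q ⟨j, p.1⟩)) hq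
    fun i => (hm i j).comp (f := Prod.swap) continuous_swap.continuousGeneratedBy
  exact h1.comp (f := Prod.swap) continuous_swap.continuousGeneratedBy

end Quotients

/-- `B` is an abelian group object in compactly generated spaces. -/
class KTopAddGroup (B : Type v) [AddCommGroup B] [TopologicalSpace B] : Prop where
  cg : CG.{u} B
  add : KContinuous.{u} fun p : B × B => p.1 + p.2
  neg : Continuous fun b : B => -b

section KTopAddGroup

variable {B : Type v} [AddCommGroup B] [TopologicalSpace B]

theorem KTopAddGroup.add_comp [KTopAddGroup.{u} B] {Z : Type w} [TopologicalSpace Z]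
    [CG.{u} Z] {f g : Z → B} (hf : Continuous f) (hg : Continuous g) :
    Continuous fun z => f z + g z :=
  continuous_of_kContinuous.{u} (KTopAddGroup.add.comp (hf.prodMk hg).continuousGeneratedBy)

theorem KTopAddGroup.sum_comp [KTopAddGroup.{u} B] {Z : Type w} [TopologicalSpace Z]
    [CG.{u} Z] {ι : Type*} (s : Finset ι) {f : ι → Z → B} (hf : ∀ i, Continuous (f i)) :
    Continuous fun z => ∑ i ∈ s, f i z := by
  classical
  induction s using Finset.induction_on with
  | empty => simpa using continuous_const
  | insert a s ha ih =>
    simp only [Finset.sum_insert ha]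
    exact KTopAddGroup.add_comp.{u} (hf a) ih

instance quotientKTop [KTopAddGroup.{u} B] (N : AddSubgroup B) : KTopAddGroup.{u} (B ⧸ N) where
  cg := by
    have := KTopAddGroup.cg.{u} (B := B)
    exact (isQuotientMap_quotient_mk').isGeneratedBy
  add := by
    have := KTopAddGroup.cg.{u} (B := B)
    refine kContinuous_of_quotient (q := ((↑) : B → B ⧸ N)) isQuotientMap_quotient_mk' ?_
    have h : Continuous ((↑) : B → B ⧸ N) := continuous_quotient_mk'
    exact h.continuousGeneratedBy.comp (KTopAddGroup.add.{u} (B := B))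
  neg := by
    refine (isQuotientMap_quotient_mk' (s := QuotientAddGroup.leftRel N)).continuous_iff.2 ?_
    have h : Continuous ((↑) : B → B ⧸ N) := continuous_quotient_mk'
    exact h.comp KTopAddGroup.neg.{u}

end KTopAddGroup

theorem continuous_quotientMap {B : Type v} {B' : Type w} [AddCommGroup B] [TopologicalSpace B]
    [AddCommGroup B'] [TopologicalSpace B'] {N : AddSubgroup B} {N' : AddSubgroup B'} {f : B →+ B'}
    (h : N ≤ N'.comap f) (hf : Continuous f) : Continuous (QuotientAddGroup.map N N' f h) := by
  refine (isQuotientMap_quotient_mk' (s := QuotientAddGroup.leftRel N)).continuous_iff.2 ?_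
  have hq : Continuous ((↑) : B' → B' ⧸ N') := continuous_quotient_mk'
  exact hq.comp hf

/-! ### Finite `G`-sets -/

/-- A finite set with an action of `G`. -/
structure FinGSet (G : Type u) [Group G] : Type (u + 1) where
  carrier : Type u
  [finite : Finite carrier]
  [action : MulAction G carrier]

instance (G : Type u) [Group G] : CoeSort (FinGSet G) (Type u) := ⟨FinGSet.carrier⟩

attribute [instance] FinGSet.finite FinGSet.action

namespace FinGSet

variable {G : Type u} [Group G]

/-- The disjoint union. -/
def sum (S T : FinGSet G) : FinGSet G := ⟨S ⊕ T⟩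

def inl (S T : FinGSet G) : S →[G] S.sum T := ⟨Sum.inl, fun _ _ => rfl⟩

def inr (S T : FinGSet G) : T →[G] S.sum T := ⟨Sum.inr, fun _ _ => rfl⟩

/-- The map out of a disjoint union given by two maps. -/
def copair {S T : FinGSet G} {Y : Type v} [MulAction G Y] (φ : S →[G] Y) (ψ : T →[G] Y) :
    S.sum T →[G] Y :=
  ⟨Sum.elim φ ψ, by 
    rintro g (s | t)
    · exact map_smul φ g s
    · exact map_smul ψ g t⟩

/-- The fibre product of two maps of finite `G`-sets. -/
def pullback {C S T : FinGSet G} (τ : C →[G] T) (f : S →[G] T) : FinGSet G :=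
  letI : MulAction G {p : C × S // τ p.1 = f p.2} :=
    { smul := fun g p => ⟨g • p.1, by simp [p.2]⟩
      one_smul := fun p => Subtype.ext (one_smul G p.1)
      mul_smul := fun g h p => Subtype.ext (mul_smul g h p.1) }
  ⟨{p : C × S // τ p.1 = f p.2}⟩

def pullbackFst {C S T : FinGSet G} (τ : C →[G] T) (f : S →[G] T) : pullback τ f →[G] C :=
  ⟨fun p => p.1.1, fun _ _ => rfl⟩

def pullbackSnd {C S T : FinGSet G} (τ : C →[G] T) (f : S →[G] T) : pullback τ f →[G] S :=
  ⟨fun p => p.1.2, fun _ _ => rfl⟩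

/-- The square with `f : A → B`, `g : A → C`, `h : B → D`, `k : C → D` is a pullback square. -/
def IsPB {A B C D : FinGSet G} (f : A →[G] B) (g : A →[G] C) (h : B →[G] D) (k : C →[G] D) :
    Prop :=
  (∀ a, h (f a) = k (g a)) ∧ ∀ b c, h b = k c → ∃! a, f a = b ∧ g a = c

theorem isPB_pullback {C S T : FinGSet G} (τ : C →[G] T) (f : S →[G] T) :
    IsPB (pullbackSnd τ f) (pullbackFst τ f) f τ := by
  refine ⟨fun p => p.2.symm, fun b c h => ⟨⟨(c, b), h.symm⟩, ⟨rfl, rfl⟩, ?_⟩⟩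
  rintro ⟨⟨c', b'⟩, h'⟩ ⟨h1, h2⟩
  apply Subtype.ext
  exact Prod.ext h2 h1

end FinGSet

/-! ### Equivariant maps as spaces -/

section MapSpaces

variable {G : Type w} {S : Type u} {B : Type v} [SMul G S] [SMul G B] [TopologicalSpace B]

/-- The space of equivariant maps from a discrete `G`-set `S` (finite in all uses) to a `G`-space
`B`: the topology of pointwise convergence, which for finite `S` is the compact-open topology, made
compactly generated. -/
instance mapSpace : TopologicalSpace (S →[G] B) :=
  kify.{u} (TopologicalSpace.induced (fun φ (s : S) => φ s) inferInstance)

instance cg_map : CG.{u} (S →[G] B) := cg_kify _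

theorem continuous_eval (s : S) : Continuous fun φ : S →[G] B => φ s :=
  continuous_kify <| @Continuous.comp _ _ _ (.induced (fun (φ : S →[G] B) (s : S) => φ s) inferInstance) _ _ _ _
    (continuous_apply s) continuous_induced_dom

theorem continuous_toMap {Z : Type*} [TopologicalSpace Z] [CG.{u} Z] {F : Z → (S →[G] B)}
    (h : ∀ s, Continuous fun z => F z s) : Continuous F :=
  continuous_kify_rng (continuous_induced_rng.2 (continuous_pi h))

end MapSpaces

/-! ### `G`-spaces -/

/-- A compactly generated weak Hausdorff space with a continuous action of the discrete
group `G`. -/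
structure GSpace (G : Type u) [Group G] : Type (u + 1) where
  carrier : Type u
  [top : TopologicalSpace carrier]
  [action : MulAction G carrier]
  [cg : CG.{u} carrier]
  [wh : WeakHausdorff.{u} carrier]
  continuous_smul : ∀ g : G, Continuous fun x : carrier => g • x

instance (G : Type u) [Group G] : CoeSort (GSpace G) (Type u) := ⟨GSpace.carrier⟩

attribute [instance] GSpace.top GSpace.action GSpace.cg GSpace.wh

namespace GSpace

variable {G : Type u} [Group G]

/-- Continuous equivariant maps. -/
@[ext]
structure Hom (X Y : GSpace G) where
  map : X →[G] Y
  cont : Continuous map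

instance : Category (GSpace G) where
  Hom := Hom
  id X := ⟨MulActionHom.id G, continuous_id⟩
  comp f g := ⟨g.map.comp f.map, g.cont.comp f.cont⟩

@[simp] theorem id_map_apply (X : GSpace G) (x : X) : Hom.map (𝟙 X) x = x := rfl

@[simp] theorem comp_map_apply {X Y Z : GSpace G} (f : X ⟶ Y) (g : Y ⟶ Z) (x : X) :
    Hom.map (f ≫ g) x = Hom.map g (Hom.map f x) := rfl

/-- The product with a finite (discrete) `G`-set. -/
abbrev prodTop (X : GSpace G) (S : FinGSet G) : TopologicalSpace (X × S) :=
  kify.{u} (@instTopologicalSpaceProd X S _ ⊥)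

section Prod

variable (X : GSpace G) (S : FinGSet G)

theorem continuous_prod_fst : Continuous[prodTop X S, _] (Prod.fst : X × S → X) :=
  continuous_kify (@continuous_fst X S _ ⊥)

theorem continuous_prod_snd : Continuous[prodTop X S, ⊥] (Prod.snd : X × S → S) :=
  continuous_kify (@continuous_snd X S _ ⊥)

theorem continuous_prod_mk {Z : Type*} {tZ : TopologicalSpace Z} [CG.{u} Z] {f : Z → X} {g : Z → S}
    (hf : Continuous f) (hg : Continuous[_, ⊥] g) :
    Continuous[_, prodTop X S] fun z => (f z, g z) :=
  continuous_kify_rng (t := @instTopologicalSpaceProd X S _ ⊥) (@Continuous.prodMk _ _ _ _ ⊥ _ _ _ hf hg)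

theorem weakHausdorff_prod : @WeakHausdorff.{u} (X × S) (prodTop X S) := by
  refine @WeakHausdorff.mk _ (prodTop X S) fun K f => ?_
  let tS : TopologicalSpace S := ⊥
  have : DiscreteTopology S := ⟨rfl⟩
  have hf := @ContinuousMap.continuous _ _ _ (prodTop X S) f
  have h1 : Continuous fun k => (f k).1 :=
    @Continuous.comp _ _ _ _ (prodTop X S) _ _ _ (continuous_prod_fst X S) hf
  have h2 : Continuous fun k => (f k).2 :=
    @Continuous.comp _ _ _ _ (prodTop X S) _ _ _ (continuous_prod_snd X S) hf
  have key : Set.range f = ⋃ s : S, (Prod.fst ⁻¹' ((fun k => (f k).1) '' {k | (f k).2 = s})) ∩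
      Prod.snd ⁻¹' {s} := by
    ext ⟨x, s⟩
    simp only [Set.mem_range, Set.mem_iUnion, Set.mem_inter_iff, Set.mem_preimage, Set.mem_image,
      Set.mem_ofPred_eq, Set.mem_singleton_iff]
    constructor
    · rintro ⟨k, hk⟩
      exact ⟨s, ⟨k, by simp [hk], by simp [hk]⟩, rfl⟩
    · rintro ⟨s', ⟨k, hk, hx⟩, rfl⟩
      exact ⟨k, Prod.ext hx hk⟩
  rw [key]
  refine @isClosed_iUnion_of_finite _ _ (prodTop X S) _ _ fun s =>
    @IsClosed.inter _ _ _ (prodTop X S) ?_ ?_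
  · refine @IsClosed.preimage _ _ (prodTop X S) _ _ (continuous_prod_fst X S) _ ?_
    have hc : IsClosed {k | (f k).2 = s} := (isClosed_discrete {s}).preimage h2
    have : CompactSpace {k | (f k).2 = s} := isCompact_iff_compactSpace.1 hc.isCompact
    have hr := WeakHausdorff.isClosed_range.{u} (CompHaus.of {k | (f k).2 = s})
      (⟨fun k => (f k.1).1, h1.comp continuous_subtype_val⟩ : C({k | (f k).2 = s}, X))
    convert hr using 1
    ext x
    simp [Set.mem_range]
  · exact @IsClosed.preimage _ _ (prodTop X S) _ _ (continuous_prod_snd X S) _ (isClosed_discrete {s})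

end Prod

/-- The `G`-space `X × S` with the diagonal action. -/
def prod (X : GSpace G) (S : FinGSet G) : GSpace G :=
  letI := prodTop X S
  haveI : CG.{u} (X × S) := cg_kify _
  haveI := weakHausdorff_prod X S
  { carrier := X × S
    continuous_smul := fun g =>
      continuous_prod_mk X S ((X.continuous_smul g).comp (continuous_prod_fst X S))
        (@Continuous.comp _ _ _ (prodTop X S) ⊥ ⊥ _ (fun s : S => g • s) continuous_bot
          (continuous_prod_snd X S)) }

/-- The projections of `X × S`. -/
def prodFst {X : GSpace G} {S : FinGSet G} (p : X.prod S) : X := Prod.fst (p : X × S)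

def prodSnd {X : GSpace G} {S : FinGSet G} (p : X.prod S) : S := Prod.snd (p : X × S)

theorem continuous_prodFst {X : GSpace G} {S : FinGSet G} :
    Continuous (prodFst : X.prod S → X) := continuous_prod_fst X S

theorem continuous_prodSnd {X : GSpace G} {S : FinGSet G} :
    Continuous[_, ⊥] (prodSnd : X.prod S → S) := continuous_prod_snd X S

theorem continuous_toProd {X : GSpace G} {S : FinGSet G} {Z : Type*} [TopologicalSpace Z]
    [CG.{u} Z] {F : Z → X.prod S} (h1 : Continuous fun z => prodFst (F z))
    (h2 : Continuous[_, ⊥] fun z => prodSnd (F z)) : Continuous F :=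
  continuous_prod_mk X S h1 h2

/-- The one-point `G`-space. -/
def point (G : Type u) [Group G] : GSpace G :=
  letI : MulAction G PUnit.{u + 1} :=
    { smul := fun _ x => x
      one_smul := fun _ => rfl
      mul_smul := fun _ _ _ => rfl }
  haveI : CG.{u} PUnit.{u + 1} := cg_of_discrete
  haveI : WeakHausdorff.{u} PUnit.{u + 1} := ⟨fun _ _ => isClosed_discrete _⟩
  { carrier := PUnit.{u + 1}
    continuous_smul := fun _ => continuous_of_discreteTopology }

/-- The underlying space, as a space with an action of the trivial group. -/
def underlying (X : GSpace G) : GSpace PUnit.{u + 1} :=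
  letI : MulAction PUnit.{u + 1} X :=
    { smul := fun _ x => x
      one_smul := fun _ => rfl
      mul_smul := fun _ _ _ => rfl }
  { carrier := X
    continuous_smul := fun _ => continuous_id }

end GSpace

/-- A `G`-space with a `G`-fixed base point. -/
structure BasedGSpace (G : Type u) [Group G] : Type (u + 1) where
  space : GSpace G
  pt : space
  smul_pt : ∀ g : G, g • pt = pt

namespace BasedGSpace

variable {G : Type u} [Group G]

/-- Base point preserving continuous equivariant maps. -/
@[ext]
structure Hom (X Y : BasedGSpace G) where
  map : X.space ⟶ Y.space
  map_pt : map.map X.pt = Y.pt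

instance : Category (BasedGSpace G) where
  Hom := Hom
  id X := ⟨𝟙 X.space, rfl⟩
  comp f g := ⟨f.map ≫ g.map, by simp [f.map_pt, g.map_pt]⟩

/-- The inclusion of the base point. -/
def incl (X : BasedGSpace G) : GSpace.point G ⟶ X.space where
  map := ⟨fun _ => X.pt, fun g _ => (X.smul_pt g).symm⟩
  cont := continuous_const

/-- Forgetting the base point. -/
def forget (G : Type u) [Group G] : BasedGSpace G ⥤ GSpace G where
  obj X := X.space
  map f := Hom.map f

end BasedGSpace

/-! ### Fixed points and the Weyl group -/

/-- The Weyl group `N H / H`. -/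
abbrev Weyl {G : Type u} [Group G] (H : Subgroup G) : Type u :=
  Subgroup.normalizer (H : Set G) ⧸ H.subgroupOf (Subgroup.normalizer (H : Set G))

section Fixed

variable {G : Type u} [Group G] (H : Subgroup G)

/-- The points of `X` fixed by `H`. -/
@[ext]
structure Fixed (X : Type v) [MulAction G X] : Type v where
  val : X
  smul_val : ∀ h ∈ H, h • val = val

variable {X : Type v} [MulAction G X]

/-- The action of the normalizer of `H` on the `H`-fixed points. -/
abbrev normalizerAction : MulAction (Subgroup.normalizer (H : Set G)) (Fixed H X) where
  smul n x := ⟨(n : G) • x.val, fun h hh => by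
    have hn : (n : G)⁻¹ * h * n ∈ H := by
      have := (Subgroup.mem_normalizer_iff.1 (inv_mem n.2) h).1 hh
      simpa using this
    have h2 := x.smul_val _ hn
    rw [mul_smul, mul_smul, inv_smul_eq_iff] at h2
    exact h2⟩
  one_smul x := Fixed.ext (one_smul G x.val)
  mul_smul m n x := Fixed.ext (mul_smul (m : G) (n : G) x.val)

/-- The Weyl group acts on the `H`-fixed points by `(n H) • x = n • x`. -/
instance weylAction : MulAction (Weyl H) (Fixed H X) :=
  letI := normalizerAction H (X := X)
  MulAction.compHom (Fixed H X) (QuotientGroup.lift (H.subgroupOf (Subgroup.normalizer (H : Set G)))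
    (MulAction.toEndHom (M := Subgroup.normalizer (H : Set G)) (α := Fixed H X))
    (by
      intro n hn
      funext x
      exact Fixed.ext (x.smul_val _ (Subgroup.mem_subgroupOf.1 hn))))

theorem weyl_smul_val (n : Subgroup.normalizer (H : Set G)) (x : Fixed H X) :
    ((QuotientGroup.mk n : Weyl H) • x).val = (n : G) • x.val := rfl

/-- The restriction of a `G`-map to `H`-fixed points, as a map of sets with an action of the Weyl
group. -/
def fixedMap {Y : Type w} [MulAction G Y] (f : X →[G] Y) : Fixed H X →[Weyl H] Fixed H Y where
  toFun x := ⟨f x.val, fun h hh => by rw [← map_smul, x.smul_val h hh]⟩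
  map_smul' g x := by
    induction g using QuotientGroup.induction_on with
    | H n => exact Fixed.ext (map_smul f (n : G) x.val)

end Fixed

instance {G : Type u} [Group G] (H : Subgroup G) (S : FinGSet G) : Finite (Fixed H S) :=
  Finite.of_injective Fixed.val fun _ _ => Fixed.ext

namespace GSpace

variable {G : Type u} [Group G] (H : Subgroup G)

/-- The subspace topology on the fixed points, made compactly generated. -/
instance fixedTop (X : GSpace G) : TopologicalSpace (Fixed H X) :=
  kify.{u} (TopologicalSpace.induced Fixed.val X.top)

theorem continuous_fixed_val (X : GSpace G) : Continuous (Fixed.val : Fixed H X → X) :=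
  continuous_kify continuous_induced_dom

theorem continuous_fixed_mk {X : GSpace G} {Z : Type*} [TopologicalSpace Z] [CG.{u} Z]
    {f : Z → Fixed H X} (hf : Continuous fun z => (f z).val) : Continuous f :=
  continuous_kify_rng (continuous_induced_rng.2 hf)

instance cg_fixed (X : GSpace G) : CG.{u} (Fixed H X) := cg_kify _

instance weakHausdorff_fixed (X : GSpace G) : WeakHausdorff.{u} (Fixed H X) where
  isClosed_range K f := by
    have h := WeakHausdorff.isClosed_range.{u} K
      ⟨fun k => (f k).val, (continuous_fixed_val H X).comp f.continuous⟩
    have h2 := h.preimage (continuous_fixed_val H X)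
    convert h2 using 1
    ext x
    constructor
    · rintro ⟨k, rfl⟩
      exact ⟨k, rfl⟩
    · rintro ⟨k, hk⟩
      exact ⟨k, Fixed.ext hk⟩

/-- The functor `X ↦ X^H` from `G`-spaces to `WH`-spaces. -/
def fixed : GSpace G ⥤ GSpace (Weyl H) where
  obj X :=
    { carrier := Fixed H X
      continuous_smul := fun g => by
        induction g using QuotientGroup.induction_on with
        | H n =>
          exact continuous_fixed_mk H ((X.continuous_smul n).comp (continuous_fixed_val H X)) }
  map f := ⟨fixedMap H (Hom.map f),
    continuous_fixed_mk H ((Hom.cont f).comp (continuous_fixed_val H _))⟩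

end GSpace

/-- The functor `X ↦ X^H` from based `G`-spaces to based `WH`-spaces. -/
def BasedGSpace.fixed {G : Type u} [Group G] (H : Subgroup G) :
    BasedGSpace G ⥤ BasedGSpace (Weyl H) where
  obj X :=
    { space := (GSpace.fixed H).obj X.space
      pt := (⟨X.pt, fun h _ => X.smul_pt h⟩ : Fixed H X.space)
      smul_pt := fun g => by
        induction g using QuotientGroup.induction_on with
        | H n => exact Fixed.ext (X.smul_pt n) }
  map f := ⟨(GSpace.fixed H).map (Hom.map f), Fixed.ext (Hom.map_pt f)⟩

/-! ### Modules -/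

/-- A (discrete) `G`-module. -/
structure GModule (G : Type u) [Group G] : Type (max u (v + 1)) where
  carrier : Type v
  [grp : AddCommGroup carrier]
  [action : DistribMulAction G carrier]

instance (G : Type u) [Group G] : CoeSort (GModule.{u, v} G) (Type v) := ⟨GModule.carrier⟩

attribute [instance] GModule.grp GModule.action

instance (G : Type u) [Group G] : Category (GModule.{u, v} G) where
  Hom A B := A →+[G] B
  id A := DistribMulActionHom.id G
  comp f g := DistribMulActionHom.comp g f

/-- A topological `G`-module: an abelian group object in compactly generated spaces on which `G`
acts by continuous automorphisms. -/
structure TopGModule (G : Type u) [Group G] : Type (max u (v + 1)) extends GModule.{u, v} G where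
  [top : TopologicalSpace carrier]
  [ktop : KTopAddGroup.{u} carrier]
  continuous_smul : ∀ g : G, Continuous fun x : carrier => g • x

instance (G : Type u) [Group G] : CoeSort (TopGModule.{u, v} G) (Type v) := ⟨fun A => A.carrier⟩

attribute [instance] TopGModule.top TopGModule.ktop

/-- Continuous homomorphisms of `G`-modules. -/
@[ext]
structure TopGModule.Hom {G : Type u} [Group G] (A B : TopGModule.{u, v} G) where
  map : A →+[G] B
  cont : Continuous map

instance (G : Type u) [Group G] : Category (TopGModule.{u, v} G) where
  Hom := TopGModule.Hom
  id A := ⟨DistribMulActionHom.id G, continuous_id⟩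
  comp f g := ⟨DistribMulActionHom.comp g.map f.map, g.cont.comp f.cont⟩

/-! ### Summation over fibres -/

section Transfer

variable {S T A : Type*} [Finite S] [AddCommGroup A]

/-- `transfer f ψ t` is the sum of `ψ s` over all `s` with `f s = t`. -/
def transfer (f : S → T) (ψ : S → A) (t : T) : A :=
  ∑ s ∈ (Set.toFinite (f ⁻¹' {t})).toFinset, ψ s

theorem transfer_add (f : S → T) (ψ χ : S → A) :
    transfer f (ψ + χ) = transfer f ψ + transfer f χ :=
  funext fun _ => Finset.sum_add_distrib

theorem transfer_injective {f : S → T} (hf : Function.Injective f) (ψ : S → A) (s : S) :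
    transfer f ψ (f s) = ψ s := by
  refine (Finset.sum_eq_single s ?_ ?_)
  · intro b hb hbs
    exact absurd (hf (by simpa using hb)) hbs
  · intro h
    simp at h

theorem transfer_id (ψ : S → A) : transfer (fun s => s) ψ = ψ :=
  funext fun s => transfer_injective (f := fun s => s) (fun _ _ h => h) ψ s

theorem transfer_eq_zero {f : S → T} {t : T} (h : ∀ s, f s ≠ t) (ψ : S → A) :
    transfer f ψ t = 0 :=
  Finset.sum_eq_zero fun s hs => absurd (by simpa using hs) (h s)

theorem transfer_comp [Finite T] {U : Type*} (f : S → T) (g : T → U) (ψ : S → A) :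
    transfer (fun s => g (f s)) ψ = transfer g (transfer f ψ) := by
  classical
  funext u
  unfold transfer
  rw [← Finset.sum_fiberwise_of_maps_to (t := (Set.toFinite (g ⁻¹' {u})).toFinset) (g := f)
    (by simp)]
  refine Finset.sum_congr rfl fun t ht => Finset.sum_congr ?_ fun _ _ => rfl
  ext s
  simp only [Set.Finite.mem_toFinset, Set.mem_preimage, Set.mem_singleton_iff,
    Finset.mem_filter] at ht ⊢
  exact ⟨fun h => h.2, fun h => ⟨by rw [h, ht], h⟩⟩

theorem transfer_base_change {B C : Type*} [Finite C] {f : S → B} {g : S → C} {h : B → T}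
    {k : C → T} (hc : ∀ a, h (f a) = k (g a)) (hu : ∀ b c, h b = k c → ∃! a, f a = b ∧ g a = c)
    (ψ : C → A) (b : B) : transfer k ψ (h b) = transfer f (fun a => ψ (g a)) b := by
  symm
  refine Finset.sum_nbij g ?_ ?_ ?_ fun _ _ => rfl
  · intro a ha
    simp only [Set.Finite.mem_toFinset, Set.mem_preimage, Set.mem_singleton_iff] at ha ⊢
    rw [← hc, ha]
  · intro a ha a' ha' e
    simp only [Set.Finite.coe_toFinset, Set.mem_preimage, Set.mem_singleton_iff] at ha ha'
    exact (hu b (g a) (by rw [← ha, hc])).unique ⟨ha, rfl⟩ ⟨ha', e.symm⟩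
  · intro c hcm
    simp only [Set.Finite.coe_toFinset, Set.mem_preimage, Set.mem_singleton_iff] at hcm
    obtain ⟨a, ⟨h1, h2⟩, -⟩ := hu b c hcm.symm
    exact ⟨a, by simpa using h1, h2⟩

theorem transfer_smul {G : Type*} [Group G] [MulAction G S] [MulAction G T] [DistribMulAction G A]
    {f : S → T} {ψ : S → A} (hf : ∀ (g : G) s, f (g • s) = g • f s)
    (hψ : ∀ (g : G) s, ψ (g • s) = g • ψ s) (g : G) (t : T) :
    transfer f ψ (g • t) = g • transfer f ψ t := by
  unfold transfer
  rw [Finset.smul_sum]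
  symm
  refine Finset.sum_nbij (g • ·) ?_ ?_ ?_ fun s _ => (hψ g s).symm
  · intro s hs
    simp only [Set.Finite.mem_toFinset, Set.mem_preimage, Set.mem_singleton_iff] at hs ⊢
    rw [hf, hs]
  · intro s _ s' _ e
    exact smul_left_cancel g e
  · intro s hs
    simp only [Set.Finite.coe_toFinset, Set.mem_preimage, Set.mem_singleton_iff] at hs
    refine ⟨g⁻¹ • s, ?_, smul_inv_smul g s⟩
    simp [hf, hs]

theorem transfer_decomp {S' : Type*} [Finite S'] {i : S → T} {j : S' → T}
    (hi : Function.Injective i) (hj : Function.Injective j) (hij : ∀ s s', i s ≠ j s')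
    (hc : ∀ t, (∃ s, i s = t) ∨ ∃ s, j s = t) (ψ : T → A) :
    transfer i (fun s => ψ (i s)) + transfer j (fun s => ψ (j s)) = ψ := by
  funext t
  rcases hc t with ⟨s, rfl⟩ | ⟨s, rfl⟩
  · rw [Pi.add_apply, transfer_injective hi, transfer_eq_zero fun s' => (hij s s').symm, add_zero]
  · rw [Pi.add_apply, transfer_injective hj, transfer_eq_zero fun s' => hij s' s, zero_add]

theorem map_transfer {B F : Type*} [AddCommGroup B] [FunLike F A B] [AddMonoidHomClass F A B]
    (a : F) (f : S → T) (ψ : S → A) (t : T) :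
    a (transfer f ψ t) = transfer f (fun s => a (ψ s)) t :=
  map_sum a _ _

end Transfer

/-! ### Coefficient systems and Mackey functors -/

open FinGSet

/-- A covariant coefficient system: a covariant functor from finite `G`-sets to abelian groups
that transforms disjoint unions into direct sums. -/
structure CoeffSystem (G : Type u) [Group G] : Type (max (u + 1) (w + 1)) where
  obj : FinGSet G → Type w
  [grp : ∀ S, AddCommGroup (obj S)]
  cov : ∀ {S T : FinGSet G}, (S →[G] T) → obj S →+ obj T
  cov_id : ∀ (S : FinGSet G) (x : obj S), cov (MulActionHom.id G) x = x
  cov_comp : ∀ {S T U : FinGSet G} (f : S →[G] T) (g : T →[G] U) (x : obj S),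
    cov (g.comp f) x = cov g (cov f x)
  cov_sum : ∀ S T : FinGSet G,
    Function.Bijective fun p : obj S × obj T => cov (inl S T) p.1 + cov (inr S T) p.2

attribute [instance] CoeffSystem.grp

/-- A Mackey functor. -/
structure MackeyFunctor (G : Type u) [Group G] : Type (max (u + 1) (w + 1)) extends
    CoeffSystem.{u, w} G where
  contra : ∀ {S T : FinGSet G}, (S →[G] T) → obj T →+ obj S
  contra_id : ∀ (S : FinGSet G) (x : obj S), contra (MulActionHom.id G) x = x
  contra_comp : ∀ {S T U : FinGSet G} (f : S →[G] T) (g : T →[G] U) (x : obj U),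
    contra (g.comp f) x = contra f (contra g x)
  contra_sum : ∀ S T : FinGSet G,
    Function.Bijective fun x : obj (S.sum T) => (contra (inl S T) x, contra (inr S T) x)
  base_change : ∀ {A B C D : FinGSet G} {f : A →[G] B} {g : A →[G] C} {h : B →[G] D}
    {k : C →[G] D}, IsPB f g h k → ∀ x : obj C, contra h (cov k x) = cov f (contra g x)

/-- A topological Mackey functor: a Mackey functor with values in topological abelian groups
(abelian group objects in compactly generated spaces) and continuous homomorphisms. -/
structure TopMackeyFunctor (G : Type u) [Group G] : Type (max (u + 1) (w + 1)) extends
    MackeyFunctor.{u, w} G where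
  [top : ∀ S, TopologicalSpace (obj S)]
  [ktop : ∀ S, KTopAddGroup.{u} (obj S)]
  continuous_cov : ∀ {S T : FinGSet G} (f : S →[G] T), Continuous (cov f)
  continuous_contra : ∀ {S T : FinGSet G} (f : S →[G] T), Continuous (contra f)

attribute [instance] TopMackeyFunctor.top TopMackeyFunctor.ktop

/-- A natural transformation of coefficient systems. -/
@[ext]
structure CoeffSystem.Hom {G : Type u} [Group G] (k l : CoeffSystem.{u, w} G) where
  app : ∀ S, k.obj S →+ l.obj S
  app_cov : ∀ {S T : FinGSet G} (f : S →[G] T) (x : k.obj S),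
    app T (k.cov f x) = l.cov f (app S x)

/-- A morphism of Mackey functors: natural for both functorialities. -/
@[ext]
structure MackeyFunctor.Hom {G : Type u} [Group G] (M N : MackeyFunctor.{u, w} G) extends
    CoeffSystem.Hom M.toCoeffSystem N.toCoeffSystem where
  app_contra : ∀ {S T : FinGSet G} (f : S →[G] T) (x : M.obj T),
    app S (M.contra f x) = N.contra f (app T x)

instance (G : Type u) [Group G] : Category (MackeyFunctor.{u, w} G) where
  Hom := MackeyFunctor.Hom
  id M := ⟨⟨fun S => AddMonoidHom.id _, fun _ _ => rfl⟩, fun _ _ => rfl⟩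
  comp f g := ⟨⟨fun S => (g.app S).comp (f.app S), fun h x => by simp [f.app_cov, g.app_cov]⟩,
    fun h x => by simp [f.app_contra, g.app_contra]⟩

/-- A morphism of topological Mackey functors. -/
@[ext]
structure TopMackeyFunctor.Hom {G : Type u} [Group G] (M N : TopMackeyFunctor.{u, w} G) extends
    toMackeyHom : MackeyFunctor.Hom M.toMackeyFunctor N.toMackeyFunctor where
  cont : ∀ S, Continuous (app S)

instance (G : Type u) [Group G] : Category (TopMackeyFunctor.{u, w} G) where
  Hom := TopMackeyFunctor.Hom
  id M := ⟨⟨⟨fun S => AddMonoidHom.id _, fun _ _ => rfl⟩, fun _ _ => rfl⟩, fun _ => continuous_id⟩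
  comp f g := ⟨⟨⟨fun S => (g.app S).comp (f.app S), fun h x => by simp [f.app_cov, g.app_cov]⟩,
    fun h x => by simp [f.app_contra, g.app_contra]⟩, fun S => (g.cont S).comp (f.cont S)⟩

/-! Two facts used to check the axioms. -/

theorem biproduct_bijective {P Q R : Type*} [AddCommGroup P] [AddCommGroup Q] [AddCommGroup R]
    {i : P →+ R} {j : Q →+ R} {p : R →+ P} {q : R →+ Q} (h1 : ∀ x, p (i x) = x)
    (h2 : ∀ x, q (j x) = x) (h3 : ∀ x, p (j x) = 0) (h4 : ∀ x, q (i x) = 0)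
    (h5 : ∀ x, i (p x) + j (q x) = x) :
    (Function.Bijective fun x : P × Q => i x.1 + j x.2) ∧
      Function.Bijective fun x : R => (p x, q x) := by
  refine ⟨Function.bijective_iff_has_inverse.2 ⟨fun x => (p x, q x), fun x => ?_, h5⟩,
    Function.bijective_iff_has_inverse.2 ⟨fun x => i x.1 + j x.2, h5, fun x => ?_⟩⟩ <;>
  simp [h1, h2, h3, h4]

theorem sum_bijective {G : Type u} [Group G] {obj : FinGSet G → Type w}
    [∀ S, AddCommGroup (obj S)]
    {cov : ∀ {S T : FinGSet G}, (S →[G] T) → obj S →+ obj T}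
    {contra : ∀ {S T : FinGSet G}, (S →[G] T) → obj T →+ obj S}
    (cov_id : ∀ (S : FinGSet G) (x : obj S), cov (MulActionHom.id G) x = x)
    (contra_id : ∀ (S : FinGSet G) (x : obj S), contra (MulActionHom.id G) x = x)
    (base_change : ∀ {A B C D : FinGSet G} {f : A →[G] B} {g : A →[G] C} {h : B →[G] D}
      {k : C →[G] D}, IsPB f g h k → ∀ x : obj C, contra h (cov k x) = cov f (contra g x))
    (zero : ∀ S : FinGSet G, IsEmpty S → ∀ x : obj S, x = 0)
    (decomp : ∀ (S T : FinGSet G) (x : obj (S.sum T)),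
      cov (inl S T) (contra (inl S T) x) + cov (inr S T) (contra (inr S T) x) = x)
    (S T : FinGSet G) :
    (Function.Bijective fun p : obj S × obj T => cov (inl S T) p.1 + cov (inr S T) p.2) ∧
      Function.Bijective fun x : obj (S.sum T) => (contra (inl S T) x, contra (inr S T) x) := by
  refine biproduct_bijective (fun x => ?_) (fun x => ?_) (fun x => ?_) (fun x => ?_) (decomp S T)
  · rw [base_change (f := MulActionHom.id G) (g := MulActionHom.id G), cov_id, contra_id]
    exact ⟨fun _ => rfl, fun b c h => ⟨b, ⟨rfl, Sum.inl_injective h⟩, fun _ h => h.1⟩⟩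
  · rw [base_change (f := MulActionHom.id G) (g := MulActionHom.id G), cov_id, contra_id]
    exact ⟨fun _ => rfl, fun b c h => ⟨b, ⟨rfl, Sum.inr_injective h⟩, fun _ h => h.1⟩⟩
  · rw [base_change (isPB_pullback (inr S T) (inl S T)),
      zero _ ⟨fun p => Sum.inl_ne_inr (Subtype.property p).symm⟩ (contra _ x), map_zero]
  · rw [base_change (isPB_pullback (inl S T) (inr S T)),
      zero _ ⟨fun p => Sum.inl_ne_inr (Subtype.property p)⟩ (contra _ x), map_zero]

section Consequences

variable {G : Type u} [Group G]

theorem CoeffSystem.eq_zero_of_isEmpty (k : CoeffSystem.{u, w} G) (S : FinGSet G) (hS : IsEmpty S)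
    (x : k.obj S) : x = 0 := by
  have e : inl S S = inr S S := MulActionHom.ext fun s => hS.elim s
  have := @(k.cov_sum S S).1 (x, -x) (0, 0) (by simp [e])
  exact congrArg Prod.fst this

theorem MackeyFunctor.contra_cov_of_injective (M : MackeyFunctor.{u, w} G) {S T : FinGSet G}
    {f : S →[G] T} (hf : Function.Injective f) (x : M.obj S) : M.contra f (M.cov f x) = x := by
  rw [M.base_change (f := MulActionHom.id G) (g := MulActionHom.id G), M.cov_id, M.contra_id]
  exact ⟨fun _ => rfl, fun b c h => ⟨b, ⟨rfl, hf h⟩, fun _ h => h.1⟩⟩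

theorem MackeyFunctor.contra_cov_of_disjoint (M : MackeyFunctor.{u, w} G) {S S' T : FinGSet G}
    {f : S →[G] T} {g : S' →[G] T} (h : ∀ s s', f s ≠ g s') (x : M.obj S) :
    M.contra g (M.cov f x) = 0 := by
  rw [M.base_change (isPB_pullback f g),
    M.eq_zero_of_isEmpty _ ⟨fun p => h _ _ (Subtype.property p)⟩ (M.contra _ x), map_zero]

theorem MackeyFunctor.decomp (M : MackeyFunctor.{u, w} G) {S S' T : FinGSet G}
    {i : S →[G] T} {j : S' →[G] T} (hi : Function.Injective i) (hj : Function.Injective j)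
    (hij : ∀ s s', i s ≠ j s') (hc : ∀ t, (∃ s, i s = t) ∨ ∃ s, j s = t) (x : M.obj T) :
    M.cov i (M.contra i x) + M.cov j (M.contra j x) = x := by
  have hb : Function.Bijective (copair i j) := by
    constructor
    · rintro (s | s) (t | t) h
      · exact congrArg Sum.inl (hi h)
      · exact absurd h (hij _ _)
      · exact absurd h.symm (hij _ _)
      · exact congrArg Sum.inr (hj h)
    · intro t
      rcases hc t with ⟨s, hs⟩ | ⟨s, hs⟩
      · exact ⟨Sum.inl s, hs⟩
      · exact ⟨Sum.inr s, hs⟩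
  obtain ⟨f, hf1, hf2⟩ := Function.bijective_iff_has_inverse.1 hb
  let e : T →[G] S.sum S' := ⟨f, fun g t => by
    apply hb.1
    rw [map_smul]
    exact (hf2 _).trans (congrArg (g • ·) (hf2 t).symm)⟩
  have hx : x = M.cov (copair i j) (M.cov e x) := by
    rw [← M.cov_comp]
    have : (copair i j).comp e = MulActionHom.id G := MulActionHom.ext hf2
    rw [this, M.cov_id]
  obtain ⟨⟨a, b⟩, hab⟩ := (M.cov_sum S S').2 (M.cov e x)
  have h1 : (copair i j).comp (inl S S') = i := MulActionHom.ext fun _ => rfl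
  have h2 : (copair i j).comp (inr S S') = j := MulActionHom.ext fun _ => rfl
  have hx2 : x = M.cov i a + M.cov j b := by
    rw [hx, ← hab, map_add, ← M.cov_comp, ← M.cov_comp, h1, h2]
  have e1 := M.contra_cov_of_disjoint hij a
  have e2 := M.contra_cov_of_disjoint (fun s s' => (hij s' s).symm) b
  rw [hx2, map_add (M.contra i), map_add (M.contra j), M.contra_cov_of_injective hi,
    M.contra_cov_of_injective hj, e1, e2, add_zero, zero_add]

end Consequences

/-! ### Mackey functors of modules over the Weyl group -/

section MapGroup

variable {G S A : Type*} [Group G] [MulAction G S] [AddCommGroup A] [DistribMulAction G A]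

/-- Pointwise addition of equivariant maps. -/
instance mapGroup : AddCommGroup (S →[G] A) :=
  letI : Add (S →[G] A) := ⟨fun φ ψ => ⟨fun s => φ s + ψ s, fun g s => by simp⟩⟩
  letI : Zero (S →[G] A) := ⟨⟨fun _ => 0, fun g s => by simp⟩⟩
  letI : Neg (S →[G] A) := ⟨fun φ => ⟨fun s => -φ s, fun g s => by simp⟩⟩
  { AddGroup.ofLeftAxioms (fun φ ψ χ => MulActionHom.ext fun s => add_assoc (φ s) (ψ s) (χ s))
      (fun φ => MulActionHom.ext fun s => zero_add (φ s))
      (fun φ => MulActionHom.ext fun s => neg_add_cancel (φ s)) with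
    add_comm := fun φ ψ => MulActionHom.ext fun s => add_comm (φ s) (ψ s) }

theorem mapGroup_add_apply (φ ψ : S →[G] A) (s : S) : (φ + ψ) s = φ s + ψ s := rfl

theorem mapGroup_neg_apply (φ : S →[G] A) (s : S) : (-φ) s = -φ s := rfl

theorem mapGroup_zero_apply (s : S) : (0 : S →[G] A) s = 0 := rfl

end MapGroup

instance mapKTop {G : Type w} {S : Type u} {B : Type v} [Group G] [MulAction G S] [AddCommGroup B]
    [DistribMulAction G B] [TopologicalSpace B] [KTopAddGroup.{u} B] :
    KTopAddGroup.{u} (S →[G] B) where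
  cg := inferInstance
  add := by
    intro K f
    refine continuous_toMap fun s => ?_
    exact KTopAddGroup.add_comp.{u} ((continuous_eval s).comp (continuous_fst.comp f.continuous))
      ((continuous_eval s).comp (continuous_snd.comp f.continuous))
  neg := continuous_toMap fun s => KTopAddGroup.neg.{u}.comp (continuous_eval s)

section R

variable {G : Type u} [Group G] (H : Subgroup G)

theorem fixedMap_isPB {A B C D : FinGSet G} {f : A →[G] B} {g : A →[G] C} {h : B →[G] D}
    {k : C →[G] D} (hp : IsPB f g h k) (b : Fixed H B) (c : Fixed H C)
    (e : fixedMap H h b = fixedMap H k c) : ∃! a, fixedMap H f a = b ∧ fixedMap H g a = c := by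
  obtain ⟨a, ⟨h1, h2⟩, hu⟩ := hp.2 b.val c.val (congrArg Fixed.val e)
  refine ⟨⟨a, fun x hx => hu _ ⟨?_, ?_⟩⟩, ⟨Fixed.ext h1, Fixed.ext h2⟩, fun a' ha' =>
    Fixed.ext (hu _ ⟨congrArg Fixed.val ha'.1, congrArg Fixed.val ha'.2⟩)⟩
  · rw [map_smul, h1, b.smul_val x hx]
  · rw [map_smul, h2, c.smul_val x hx]

variable (A : GModule.{u, v} (Weyl H))

/-- The covariant functoriality of `S ↦ Hom_{WH}(S^H, A)`, by summation over fibres. -/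
def RCov {S T : FinGSet G} (f : S →[G] T) :
    (Fixed H S →[Weyl H] A) →+ (Fixed H T →[Weyl H] A) where
  toFun ψ := ⟨transfer (fixedMap H f : Fixed H S → Fixed H T) ψ,
    transfer_smul (map_smul (fixedMap H f)) (map_smul ψ)⟩
  map_zero' := MulActionHom.ext fun _ => Finset.sum_const_zero
  map_add' ψ χ := MulActionHom.ext fun t => congrFun (transfer_add _ ψ χ) t

/-- The contravariant functoriality of `S ↦ Hom_{WH}(S^H, A)`, by restriction. -/
def RContra {S T : FinGSet G} (f : S →[G] T) :
    (Fixed H T →[Weyl H] A) →+ (Fixed H S →[Weyl H] A) where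
  toFun φ := φ.comp (fixedMap H f)
  map_zero' := rfl
  map_add' _ _ := rfl

theorem RBaseChange {B C D E : FinGSet G} {f : B →[G] C} {g : B →[G] D} {h : C →[G] E}
    {k : D →[G] E} (hp : IsPB f g h k) (x : Fixed H D →[Weyl H] A) :
    RContra H A h (RCov H A k x) = RCov H A f (RContra H A g x) :=
  MulActionHom.ext fun c => transfer_base_change (S := Fixed H B) (T := Fixed H E)
    (fun a => Fixed.ext (hp.1 a.val)) (fixedMap_isPB H hp) x c

theorem RSum (S T : FinGSet G) :
    (Function.Bijective fun p : (Fixed H S →[Weyl H] A) × (Fixed H T →[Weyl H] A) =>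
      RCov H A (inl S T) p.1 + RCov H A (inr S T) p.2) ∧
      Function.Bijective fun x : Fixed H (S.sum T) →[Weyl H] A =>
        (RContra H A (inl S T) x, RContra H A (inr S T) x) := by
  refine sum_bijective (obj := fun S : FinGSet G => Fixed H S →[Weyl H] A) (cov := RCov H A)
    (contra := RContra H A) ?_ ?_ (RBaseChange H A) ?_ ?_ S T
  · exact fun _ x => MulActionHom.ext fun s => congrFun (transfer_id x) s
  · exact fun _ _ => rfl
  · exact fun _ hS x => MulActionHom.ext fun s => hS.elim s.val
  · intro S T x
    refine MulActionHom.ext fun t => congrFun (transfer_decomp (S := Fixed H S)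
      (S' := Fixed H T) (T := Fixed H (S.sum T)) ?_ ?_ ?_ ?_ x) t
    · exact fun s s' h => Fixed.ext (Sum.inl_injective (congrArg Fixed.val h))
    · exact fun s s' h => Fixed.ext (Sum.inr_injective (congrArg Fixed.val h))
    · exact fun s s' h => Sum.inl_ne_inr (congrArg Fixed.val h)
    · rintro ⟨s | s, hs⟩
      · exact Or.inl ⟨⟨s, fun h hh => Sum.inl_injective (hs h hh)⟩, rfl⟩
      · exact Or.inr ⟨⟨s, fun h hh => Sum.inr_injective (hs h hh)⟩, rfl⟩

/-- The Mackey functor `R A`, with `R A (S) = Hom_{WH}(S^H, A)`. -/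
def RObj : MackeyFunctor.{u, max u v} G where
  obj S := Fixed H S →[Weyl H] A
  cov := RCov H A
  cov_id _ x := MulActionHom.ext fun s => congrFun (transfer_id x) s
  cov_comp {S T U} f g x := MulActionHom.ext fun s =>
    congrFun (transfer_comp (S := Fixed H S) (T := Fixed H T) (U := Fixed H U) (fixedMap H f)
      (fixedMap H g) x) s
  cov_sum S T := (RSum H A S T).1
  contra := RContra H A
  contra_id _ _ := rfl
  contra_comp _ _ _ := rfl
  contra_sum S T := (RSum H A S T).2
  base_change := RBaseChange H A

/-- Composition with a homomorphism of modules. -/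
def RMap {A B : GModule.{u, v} (Weyl H)} (a : A →+[Weyl H] B) (S : FinGSet G) :
    (Fixed H S →[Weyl H] A) →+ (Fixed H S →[Weyl H] B) where
  toFun φ := a.toMulActionHom.comp φ
  map_zero' := MulActionHom.ext fun _ => map_zero a
  map_add' _ _ := MulActionHom.ext fun _ => map_add a _ _

theorem RMap_RCov {A B : GModule.{u, v} (Weyl H)} (a : A →+[Weyl H] B) {S T : FinGSet G}
    (f : S →[G] T) (x : Fixed H S →[Weyl H] A) :
    RMap H a T (RCov H A f x) = RCov H B f (RMap H a S x) :=
  MulActionHom.ext fun t => map_transfer a (fixedMap H f) x t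

/-- The functor `A ↦ R A` from `WH`-modules to Mackey functors. -/
def R : GModule.{u, v} (Weyl H) ⥤ MackeyFunctor.{u, max u v} G where
  obj := RObj H
  map a := ⟨⟨RMap H a, RMap_RCov H a⟩, fun _ _ => rfl⟩

theorem continuous_RCov (B : TopGModule.{u, v} (Weyl H)) {S T : FinGSet G} (f : S →[G] T) :
    Continuous (RCov H B.toGModule f) :=
  continuous_toMap fun _ => KTopAddGroup.sum_comp.{u} _ fun s => continuous_eval s

theorem continuous_RContra (B : TopGModule.{u, v} (Weyl H)) {S T : FinGSet G} (f : S →[G] T) :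
    Continuous (RContra H B.toGModule f) :=
  continuous_toMap fun s => continuous_eval (fixedMap H f s)

theorem continuous_RMap {A B : TopGModule.{u, v} (Weyl H)} (a : TopGModule.Hom A B)
    (S : FinGSet G) : Continuous (RMap H (A := A.toGModule) (B := B.toGModule) a.map S) :=
  continuous_toMap fun s => a.cont.comp (continuous_eval s)

/-- The functor `B ↦ R B` from topological `WH`-modules to topological Mackey functors, with
`R B (S) = Map_{WH}(S^H, B)`. -/
def RTop : TopGModule.{u, v} (Weyl H) ⥤ TopMackeyFunctor.{u, max u v} G where
  obj B :=
    { toMackeyFunctor := RObj H B.toGModule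
      top := fun S => mapSpace (G := Weyl H) (S := Fixed H S) (B := B)
      ktop := fun S => mapKTop (G := Weyl H) (S := Fixed H S) (B := B)
      continuous_cov := continuous_RCov H B
      continuous_contra := continuous_RContra H B }
  map {A B} a := ⟨(R H).map (X := A.toGModule) (Y := B.toGModule) (TopGModule.Hom.map a),
    continuous_RMap H a⟩

end R

/-! ### The coend -/

/-- The disjoint union over all finite `G`-sets `S` of `Map_G(S, X) × k(S)`, where `k(S)` is
discrete. -/
abbrev PreTensor {G : Type u} [Group G] (X : GSpace G) (k : CoeffSystem.{u, w} G) :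
    Type (max (u + 1) w) :=
  Σ p : (Σ S : FinGSet G, k.obj S), p.1 →[G] X

/-- The relation generating the equivalence relation: `(φ ∘ f, κ) ≈ (φ, f_* κ)`. -/
inductive TensorRel {G : Type u} [Group G] (X : GSpace G) (k : CoeffSystem.{u, w} G) :
    PreTensor X k → PreTensor X k → Prop
  | mk {S T : FinGSet G} (f : S →[G] T) (φ : T →[G] X) (κ : k.obj S) :
    TensorRel X k ⟨⟨S, κ⟩, φ.comp f⟩ ⟨⟨T, k.cov f κ⟩, φ⟩

/-- The coend of `S ↦ Map_G(S, X)` and `k` over finite `G`-sets, with the quotient topology. -/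
def Tensor {G : Type u} [Group G] (X : GSpace G) (k : CoeffSystem.{u, w} G) :
    Type (max (u + 1) w) := Quot (TensorRel X k)

namespace Tensor

variable {G : Type u} [Group G] {X : GSpace G} {k : CoeffSystem.{u, w} G}

instance : TopologicalSpace (Tensor X k) := inferInstanceAs (TopologicalSpace (Quot _))

/-- The class of `(φ, κ)`. -/
def mk {S : FinGSet G} (φ : S →[G] X) (κ : k.obj S) : Tensor X k := Quot.mk _ ⟨⟨S, κ⟩, φ⟩

theorem ind {P : Tensor X k → Prop} (h : ∀ (S : FinGSet G) (φ : S →[G] X) (κ : k.obj S),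
    P (mk φ κ)) (x : Tensor X k) : P x :=
  Quot.ind (fun p => h p.1.1 p.2 p.1.2) x

theorem mk_congr {S : FinGSet G} {φ φ' : S →[G] X} {κ κ' : k.obj S} (hφ : ∀ s, φ s = φ' s)
    (hκ : κ = κ') : mk φ κ = mk φ' κ' := by
  rw [MulActionHom.ext hφ, hκ]

theorem glue {S T : FinGSet G} (f : S →[G] T) (φ : T →[G] X) (κ : k.obj S) :
    mk (φ.comp f) κ = mk φ (k.cov f κ) := Quot.sound (TensorRel.mk f φ κ)

theorem mk_inl {S T : FinGSet G} (φ : S →[G] X) (ψ : T →[G] X) (κ : k.obj S) :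
    mk φ κ = mk (copair φ ψ) (k.cov (inl S T) κ) :=
  glue (inl S T) (copair φ ψ) κ

theorem mk_inr {S T : FinGSet G} (φ : S →[G] X) (ψ : T →[G] X) (κ : k.obj T) :
    mk ψ κ = mk (copair φ ψ) (k.cov (inr S T) κ) :=
  glue (inr S T) (copair φ ψ) κ

theorem isQuotientMap_mk : IsQuotientMap (Quot.mk (TensorRel X k)) := isQuotientMap_quot_mk

theorem continuous_mk {S : FinGSet G} (κ : k.obj S) :
    Continuous fun φ : S →[G] X => (mk φ κ : Tensor X k) :=
  isQuotientMap_mk.continuous.comp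
    (continuous_sigmaMk (σ := fun p : (Σ S : FinGSet G, k.obj S) => (p.1 →[G] X)) (i := ⟨S, κ⟩))

/-- The empty `G`-set. -/
def empty (G : Type u) [Group G] : FinGSet G :=
  letI : MulAction G PEmpty.{u + 1} :=
    { smul := fun _ x => x, one_smul := fun _ => rfl, mul_smul := fun _ _ _ => rfl }
  ⟨PEmpty⟩

def fromEmpty (Y : Type v) [MulAction G Y] : empty G →[G] Y :=
  ⟨fun x => PEmpty.elim x, fun _ x => PEmpty.elim x⟩

/-- Addition: `[φ, κ] + [ψ, μ] = [φ ⊔ ψ, κ ⊕ μ]`. -/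
instance : Add (Tensor X k) where
  add := Quot.lift₂ (fun p q => mk (copair p.2 q.2)
      (k.cov (inl p.1.1 q.1.1) p.1.2 + k.cov (inr p.1.1 q.1.1) q.1.2))
    (by
      rintro ⟨⟨S, κ⟩, φ⟩ _ _ ⟨f, ψ, μ⟩
      rename_i U V
      have e := glue (k := k) (copair ((inl S V).comp (MulActionHom.id G)) ((inr S V).comp f))
        (copair φ ψ) (k.cov (inl S U) κ + k.cov (inr S U) μ)
      have e2 : (copair φ ψ).comp (copair ((inl S V).comp (MulActionHom.id G)) ((inr S V).comp f)) =
          copair φ (ψ.comp f) := MulActionHom.ext (by rintro (s | s) <;> rfl)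
      rw [e2] at e
      refine e.trans (congrArg _ ?_)
      rw [map_add, ← k.cov_comp, ← k.cov_comp]
      exact congrArg₂ (· + ·) rfl (k.cov_comp f (inr S V) μ))
    (by
      rintro _ _ ⟨⟨S, κ⟩, φ⟩ ⟨f, ψ, μ⟩
      rename_i U V
      have e := glue (k := k) (copair ((inl V S).comp f) ((inr V S).comp (MulActionHom.id G)))
        (copair ψ φ) (k.cov (inl U S) μ + k.cov (inr U S) κ)
      have e2 : (copair ψ φ).comp (copair ((inl V S).comp f) ((inr V S).comp (MulActionHom.id G))) =
          copair (ψ.comp f) φ := MulActionHom.ext (by rintro (s | s) <;> rfl)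
      rw [e2] at e
      refine e.trans (congrArg _ ?_)
      rw [map_add, ← k.cov_comp, ← k.cov_comp]
      exact congrArg₂ (· + ·) (k.cov_comp f (inl V S) μ) rfl)

instance : Zero (Tensor X k) := ⟨mk (fromEmpty X) (0 : k.obj (empty G))⟩

instance : Neg (Tensor X k) where
  neg := Quot.map (fun p => ⟨⟨p.1.1, -p.1.2⟩, p.2⟩) (by
    rintro _ _ ⟨f, φ, κ⟩
    have h := TensorRel.mk (X := X) (k := k) f φ (-κ)
    rwa [map_neg] at h)

theorem mk_add_mk {S T : FinGSet G} (φ : S →[G] X) (ψ : T →[G] X) (κ : k.obj S) (μ : k.obj T) :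
    (mk φ κ + mk ψ μ : Tensor X k) =
      mk (copair φ ψ) (k.cov (inl S T) κ + k.cov (inr S T) μ) := rfl

theorem mk_add {S : FinGSet G} (φ : S →[G] X) (κ μ : k.obj S) :
    (mk φ (κ + μ) : Tensor X k) = mk φ κ + mk φ μ := by
  rw [mk_add_mk]
  have e := glue (copair (MulActionHom.id G) (MulActionHom.id G)) φ
    (k.cov (inl S S) κ + k.cov (inr S S) μ)
  have e2 : φ.comp (copair (S := S) (T := S) (MulActionHom.id G) (MulActionHom.id G)) =
      copair φ φ := MulActionHom.ext (by rintro (s | s) <;> rfl)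
  rw [e2, map_add, ← k.cov_comp, ← k.cov_comp] at e
  rw [e]
  exact congrArg (mk φ) (congrArg₂ (· + ·) (k.cov_id S κ).symm (k.cov_id S μ).symm)

theorem mk_zero {S : FinGSet G} (φ : S →[G] X) : (mk φ (0 : k.obj S) : Tensor X k) = 0 := by
  have e := glue (fromEmpty S) φ (0 : k.obj (empty G))
  rw [map_zero] at e
  rw [← e]
  exact congrArg (fun ψ => (mk ψ (0 : k.obj (empty G)) : Tensor X k))
    (MulActionHom.ext fun x => PEmpty.elim x)

theorem neg_mk {S : FinGSet G} (φ : S →[G] X) (κ : k.obj S) :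
    (-mk φ κ : Tensor X k) = mk φ (-κ) := rfl

instance : AddCommGroup (Tensor X k) :=
  { AddGroup.ofLeftAxioms
      (fun a b c : Tensor X k => by
        induction a using ind with | h S φ κ
        induction b using ind with | h T ψ μ
        induction c using ind with | h U χ ν
        rw [mk_inl φ (copair ψ χ) κ, mk_inl ψ χ μ, mk_inr ψ χ ν, mk_inr φ (copair ψ χ),
          mk_inr φ (copair ψ χ) (k.cov (inr T U) ν), ← mk_add, ← mk_add, ← mk_add, ← mk_add,
          add_assoc])
      (fun a : Tensor X k => by
        induction a using ind with | h S φ κ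
        rw [← mk_zero φ, ← mk_add, zero_add])
      (fun a : Tensor X k => by
        induction a using ind with | h S φ κ
        rw [neg_mk, ← mk_add, neg_add_cancel, mk_zero]) with
    add_comm := fun a b => by
      induction a using ind with | h S φ κ
      induction b using ind with | h T ψ μ
      rw [mk_inl φ ψ κ, mk_inr φ ψ μ, ← mk_add, ← mk_add, add_comm] }

instance : KTopAddGroup.{u} (Tensor X k) where
  cg := (isQuotientMap_mk (X := X) (k := k)).isGeneratedBy (X := test.{u})
  add := by
    refine kContinuous_of_sigma_quotient (isQuotientMap_mk (X := X) (k := k)) ?_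
    rintro ⟨S, κ⟩ ⟨T, μ⟩ K f
    refine (continuous_mk (k.cov (inl S T) κ + k.cov (inr S T) μ)).comp
      (f := fun z : test K => copair (f z).1 (f z).2) ?_
    refine continuous_toMap ?_
    rintro (s | t)
    · exact (continuous_eval s).comp (continuous_fst.comp f.continuous)
    · exact (continuous_eval t).comp (continuous_snd.comp f.continuous)
  neg := by
    refine isQuotientMap_mk.continuous_iff.2 (continuous_sigma ?_)
    rintro ⟨S, κ⟩
    exact continuous_mk (-κ)

/-- Homomorphisms out of the coend. -/
def lift {B : Type*} [AddCommGroup B] (F : ∀ S : FinGSet G, (S →[G] X) → k.obj S →+ B)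
    (hF : ∀ {S T : FinGSet G} (f : S →[G] T) (φ : T →[G] X) (κ : k.obj S),
      F S (φ.comp f) κ = F T φ (k.cov f κ)) : Tensor X k →+ B :=
  AddMonoidHom.mk' (Quot.lift (fun p => F p.1.1 p.2 p.1.2) (by
      rintro _ _ ⟨f, φ, κ⟩
      exact hF f φ κ)) (fun a b => by
    induction a using ind with | h S φ κ
    induction b using ind with | h T ψ μ
    rw [mk_inl φ ψ κ, mk_inr φ ψ μ, ← mk_add]
    exact map_add (F _ (copair φ ψ)) _ _)

theorem continuous_of_mk {B : Type*} [TopologicalSpace B] {F : Tensor X k → B}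
    (h : ∀ (S : FinGSet G) (κ : k.obj S), Continuous fun φ : S →[G] X => F (mk φ κ)) :
    Continuous F :=
  isQuotientMap_mk.continuous_iff.2 (continuous_sigma fun p => h p.1 p.2)

/-- The functoriality of the coend in both variables. -/
def map {Y : GSpace G} {l : CoeffSystem.{u, w} G} (f : X ⟶ Y) (a : CoeffSystem.Hom k l) :
    Tensor X k →+ Tensor Y l :=
  lift (fun S φ => AddMonoidHom.mk' (fun κ => mk ((GSpace.Hom.map f).comp φ) (a.app S κ))
      fun κ μ => by rw [map_add, mk_add])
    (fun g φ κ => (glue g ((GSpace.Hom.map f).comp φ) (a.app _ κ)).trans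
      (congrArg _ (a.app_cov g κ).symm))

theorem map_mk {Y : GSpace G} {l : CoeffSystem.{u, w} G} (f : X ⟶ Y) (a : CoeffSystem.Hom k l)
    {S : FinGSet G} (φ : S →[G] X) (κ : k.obj S) :
    map f a (mk φ κ) = mk ((GSpace.Hom.map f).comp φ) (a.app S κ) := rfl

theorem continuous_map {Y : GSpace G} {l : CoeffSystem.{u, w} G} (f : X ⟶ Y)
    (a : CoeffSystem.Hom k l) : Continuous (map f a) :=
  continuous_of_mk fun S κ => (continuous_mk (a.app S κ)).comp
    (f := fun φ : S →[G] X => (GSpace.Hom.map f).comp φ)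
    (continuous_toMap fun s => (GSpace.Hom.cont f).comp (continuous_eval s))

end Tensor

/-! ### The topological Mackey functor `X ⊗ M` -/

section TensorMackey

variable {G : Type u} [Group G]

/-- The product of a map of `G`-spaces and a map of finite `G`-sets. -/
def GSpace.prodMap {X Y : GSpace G} {S T : FinGSet G} (f : X ⟶ Y) (g : S →[G] T) :
    X.prod S ⟶ Y.prod T where
  map := ⟨fun p : X × S => ((GSpace.Hom.map f p.1, g p.2) : Y × T), fun c p =>
    Prod.ext (map_smul (GSpace.Hom.map f) c p.1) (map_smul g c p.2)⟩
  cont := GSpace.continuous_toProd ((GSpace.Hom.cont f).comp GSpace.continuous_prodFst)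
    (@Continuous.comp _ _ _ _ ⊥ ⊥ _ g continuous_bot GSpace.continuous_prodSnd)

variable {X : GSpace G} (M : MackeyFunctor.{u, w} G)

/-- The second component of a map to `X × T`. -/
def sndMap {C T : FinGSet G} (γ : C →[G] X.prod T) : C →[G] T :=
  ⟨fun c => GSpace.prodSnd (γ c), fun g c => congrArg GSpace.prodSnd (map_smul γ g c)⟩

/-- The map `β` from the fibre product `C ×_T S`, that is `C ×_{X × T} (X × S)`, to `X × S`. -/
def pullMap {C S T : FinGSet G} (τ : C →[G] T) (f : S →[G] T) (γ : C →[G] X.prod T) :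
    pullback τ f →[G] X.prod S :=
  ⟨fun p => ((GSpace.prodFst (γ p.1.1), p.1.2) : X × S), fun g p =>
    Prod.ext (congrArg (GSpace.prodFst (X := X) (S := T)) (map_smul γ g p.1.1)) rfl⟩

theorem MackeyFunctor.cov_contra_of_bijective {S T : FinGSet G} {e : S →[G] T}
    (he : Function.Bijective e) (x : M.obj T) : M.cov e (M.contra e x) = x := by
  rw [← M.base_change (f := e) (g := e) (h := MulActionHom.id G) (k := MulActionHom.id G),
    M.cov_id, M.contra_id]
  refine ⟨fun _ => rfl, fun b c h => ?_⟩
  obtain ⟨a, rfl⟩ := he.2 b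
  exact ⟨a, ⟨rfl, h⟩, fun a' h' => he.1 h'.1⟩

/-- The contravariant functoriality of `S ↦ (X × S) ⊗ M`: the class of `(γ, c)` is sent to the class
of `(β, F^* c)`, where `β` and `F` are the projections of the pullback of `γ : C → X × T` and
`id × f : X × S → X × T`. -/
def tensorContra {S T : FinGSet G} (f : S →[G] T) :
    Tensor (X.prod T) M.toCoeffSystem →+ Tensor (X.prod S) M.toCoeffSystem :=
  Tensor.lift (fun _ γ => AddMonoidHom.mk' (fun c => Tensor.mk (pullMap (sndMap γ) f γ)
      (M.contra (pullbackFst (sndMap γ) f) c)) fun c d => by rw [map_add, Tensor.mk_add])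
    (fun {C C'} h γ c => by
      let e : pullback (sndMap (γ.comp h)) f →[G] pullback (sndMap γ) f :=
        ⟨fun p => ⟨(h p.1.1, p.1.2), p.2⟩, fun g p =>
          Subtype.ext (Prod.ext (map_smul h g p.1.1) rfl)⟩
      have h1 := Tensor.glue (k := M.toCoeffSystem) e (pullMap (sndMap γ) f γ)
        (M.contra (pullbackFst (sndMap (γ.comp h)) f) c)
      refine h1.trans (congrArg _ (M.base_change (f := e)
        (g := pullbackFst (sndMap (γ.comp h)) f) (h := pullbackFst (sndMap γ) f) (k := h)
        ⟨fun _ => rfl, ?_⟩ c).symm)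
      rintro ⟨⟨c', s⟩, hs⟩ d hd
      change c' = h d at hd
      subst hd
      refine ⟨⟨(d, s), hs⟩, ⟨rfl, rfl⟩, ?_⟩
      rintro ⟨⟨d', s'⟩, hs'⟩ ⟨h1, h2⟩
      exact Subtype.ext (Prod.ext h2 (congrArg (fun p => p.1.2) h1)))

theorem tensorContra_mk {S T C : FinGSet G} (f : S →[G] T) (γ : C →[G] X.prod T) (c : M.obj C) :
    tensorContra M f (Tensor.mk γ c) =
      Tensor.mk (pullMap (sndMap γ) f γ) (M.contra (pullbackFst (sndMap γ) f) c) := rfl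

theorem continuous_tensorContra {S T : FinGSet G} (f : S →[G] T) :
    Continuous (tensorContra (X := X) M f) := by
  refine Tensor.continuous_of_mk fun C c => ?_
  have h1 : ∀ τ : C →[G] T, Continuous fun γ : C →[G] X.prod T =>
      (Tensor.mk (pullMap τ f γ) (M.contra (pullbackFst τ f) c) :
        Tensor (X.prod S) M.toCoeffSystem) := by
    intro τ
    refine (Tensor.continuous_mk _).comp (continuous_toMap fun p => ?_)
    have h2 : Continuous fun γ : C →[G] X.prod T => GSpace.prodFst (γ p.1.1) :=
      GSpace.continuous_prodFst.comp (continuous_eval p.1.1)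
    exact GSpace.continuous_toProd h2
      (@continuous_const _ _ _ ⊥ _)
  rw [continuous_iff_continuousAt]
  intro γ₀
  refine (h1 (sndMap γ₀)).continuousAt.congr ?_
  have h2 : ∀ᶠ γ in nhds γ₀, sndMap γ = sndMap γ₀ := by
    have h3 : ∀ d : C, ∀ᶠ γ : C →[G] X.prod T in nhds γ₀, sndMap γ d = sndMap γ₀ d := by
      intro d
      let tT : TopologicalSpace T := ⊥
      have : DiscreteTopology T := ⟨rfl⟩
      have hc : Continuous fun γ : C →[G] X.prod T => sndMap γ d :=
        GSpace.continuous_prodSnd.comp (continuous_eval d)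
      exact hc.continuousAt.eventually (p := fun t => t = sndMap γ₀ d)
        ((isOpen_discrete {sndMap γ₀ d}).mem_nhds rfl)
    filter_upwards [Filter.eventually_all.2 h3] with γ hγ
    exact MulActionHom.ext hγ
  filter_upwards [h2] with γ hγ
  change _ = Tensor.mk (pullMap (sndMap γ) f γ) (M.contra (pullbackFst (sndMap γ) f) c)
  rw [hγ]

/-- The covariant functoriality of `S ↦ (X × S) ⊗ M`. -/
def tensorCov {S T : FinGSet G} (f : S →[G] T) :
    Tensor (X.prod S) M.toCoeffSystem →+ Tensor (X.prod T) M.toCoeffSystem :=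
  Tensor.map (GSpace.prodMap (𝟙 X) f) (MackeyFunctor.Hom.toHom (𝟙 M))

theorem tensorContra_id (S : FinGSet G) (x : Tensor (X.prod S) M.toCoeffSystem) :
    tensorContra M (MulActionHom.id G) x = x := by
  induction x using Tensor.ind with | h C γ c
  have e := Tensor.glue (k := M.toCoeffSystem) (pullbackFst (sndMap γ) (MulActionHom.id G)) γ
    (M.contra (pullbackFst (sndMap γ) (MulActionHom.id G)) c)
  rw [M.cov_contra_of_bijective] at e
  · refine Eq.trans ?_ e
    rw [tensorContra_mk]
    refine congrArg (fun φ : pullback (sndMap γ) (MulActionHom.id G) →[G] X.prod S =>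
      (Tensor.mk φ _ : Tensor (X.prod S) M.toCoeffSystem)) ?_
    exact MulActionHom.ext fun p => Prod.ext rfl (Subtype.property p).symm
  · constructor
    · intro p q h
      exact Subtype.ext (Prod.ext h (p.2.symm.trans ((congrArg (sndMap γ) h).trans q.2)))
    · intro d
      exact ⟨⟨(d, sndMap γ d), rfl⟩, rfl⟩

theorem tensorContra_comp {S T U : FinGSet G} (f : S →[G] T) (g : T →[G] U)
    (x : Tensor (X.prod U) M.toCoeffSystem) :
    tensorContra M (g.comp f) x = tensorContra M f (tensorContra M g x) := by
  induction x using Tensor.ind with | h C γ c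
  rw [tensorContra_mk, tensorContra_mk, tensorContra_mk]
  let e : pullback (sndMap γ) (g.comp f) →[G] pullback (sndMap (pullMap (sndMap γ) g γ)) f :=
    ⟨fun p => ⟨(⟨(p.1.1, f p.1.2), p.2⟩, p.1.2), rfl⟩, fun h p =>
      Subtype.ext (Prod.ext (Subtype.ext (Prod.ext rfl (map_smul f h p.1.2))) rfl)⟩
  have he : Function.Bijective e := by
    constructor
    · intro p q h
      exact Subtype.ext (Prod.ext (congrArg (fun z => z.1.1.1.1) h) (congrArg (fun z => z.1.2) h))
    · rintro ⟨⟨⟨⟨d, t⟩, h1⟩, s⟩, h2⟩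
      change t = f s at h2
      subst h2
      exact ⟨⟨(d, s), h1⟩, rfl⟩
  refine Eq.trans (Tensor.glue (k := M.toCoeffSystem) e
    (pullMap (sndMap (pullMap (sndMap γ) g γ)) f (pullMap (sndMap γ) g γ))
    (M.contra (pullbackFst (sndMap γ) (g.comp f)) c)) (congrArg _ ?_)
  rw [← M.contra_comp, ← M.cov_contra_of_bijective he (M.contra _ c)]
  congr 1
  rw [← M.contra_comp]
  rfl

theorem tensor_base_change {A B C D : FinGSet G} {f : A →[G] B} {g : A →[G] C} {h : B →[G] D}
    {k : C →[G] D} (hp : IsPB f g h k) (x : Tensor (X.prod C) M.toCoeffSystem) :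
    tensorContra M h (tensorCov M k x) = tensorCov M f (tensorContra M g x) := by
  induction x using Tensor.ind with | h E γ c
  let γ' := (GSpace.Hom.map (GSpace.prodMap (𝟙 X) k)).comp γ
  let e : pullback (sndMap γ) g →[G] pullback (sndMap γ') h :=
    ⟨fun p => ⟨(p.1.1, f p.1.2), (congrArg k p.2).trans (hp.1 p.1.2).symm⟩, fun d p =>
      Subtype.ext (Prod.ext rfl (map_smul f d p.1.2))⟩
  have he : Function.Bijective e := by
    constructor
    · intro p q hpq
      have h1 : p.1.1 = q.1.1 := congrArg (fun z => z.1.1) hpq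
      have h2 : f p.1.2 = f q.1.2 := congrArg (fun z => z.1.2) hpq
      refine Subtype.ext (Prod.ext h1 ((hp.2 (f p.1.2) (g p.1.2) (hp.1 _)).unique ⟨rfl, rfl⟩
        ⟨h2.symm, ?_⟩))
      rw [← q.2, ← h1]
      exact p.2
    · rintro ⟨⟨d, b⟩, hb⟩
      obtain ⟨a, ⟨h1, h2⟩, -⟩ := hp.2 b (sndMap γ d) hb.symm
      exact ⟨⟨(d, a), h2.symm⟩, Subtype.ext (Prod.ext rfl h1)⟩
  symm
  refine Eq.trans (Tensor.glue (k := M.toCoeffSystem) e (pullMap (sndMap γ') h γ')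
    (M.contra (pullbackFst (sndMap γ) g) c)) (congrArg _ ?_)
  refine Eq.trans ?_ (M.cov_contra_of_bijective he (M.contra (pullbackFst (sndMap γ') h) c))
  congr 1
  rw [← M.contra_comp]
  rfl

theorem tensor_sum (S T : FinGSet G) :
    (Function.Bijective fun p : Tensor (X.prod S) M.toCoeffSystem ×
        Tensor (X.prod T) M.toCoeffSystem =>
      tensorCov M (inl S T) p.1 + tensorCov M (inr S T) p.2) ∧
      Function.Bijective fun x : Tensor (X.prod (S.sum T)) M.toCoeffSystem =>
        (tensorContra M (inl S T) x, tensorContra M (inr S T) x) := by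
  refine sum_bijective (obj := fun S : FinGSet G => Tensor (X.prod S) M.toCoeffSystem)
    (cov := tensorCov M) (contra := tensorContra M) ?_ (tensorContra_id M)
    (tensor_base_change M) ?_ ?_ S T
  · intro S x
    induction x using Tensor.ind with | h C γ c
    rfl
  · intro S hS x
    induction x using Tensor.ind with | h C γ c
    rw [M.eq_zero_of_isEmpty C ⟨fun d => hS.elim (sndMap γ d)⟩ c, Tensor.mk_zero]
  · intro S T x
    induction x using Tensor.ind with | h C γ c
    have h1 := Tensor.glue (k := M.toCoeffSystem) (pullbackFst (sndMap γ) (inl S T)) γ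
      (M.contra (pullbackFst (sndMap γ) (inl S T)) c)
    have h2 := Tensor.glue (k := M.toCoeffSystem) (pullbackFst (sndMap γ) (inr S T)) γ
      (M.contra (pullbackFst (sndMap γ) (inr S T)) c)
    have e1 : tensorCov M (inl S T) (tensorContra M (inl S T) (Tensor.mk γ c)) =
        Tensor.mk γ (M.cov (pullbackFst (sndMap γ) (inl S T))
          (M.contra (pullbackFst (sndMap γ) (inl S T)) c)) := by
      rw [← h1]
      refine congrArg (fun φ : pullback (sndMap γ) (inl S T) →[G] X.prod (S.sum T) =>
        (Tensor.mk φ _ : Tensor (X.prod (S.sum T)) M.toCoeffSystem)) ?_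
      exact MulActionHom.ext fun p => Prod.ext rfl (Subtype.property p).symm
    have e2 : tensorCov M (inr S T) (tensorContra M (inr S T) (Tensor.mk γ c)) =
        Tensor.mk γ (M.cov (pullbackFst (sndMap γ) (inr S T))
          (M.contra (pullbackFst (sndMap γ) (inr S T)) c)) := by
      rw [← h2]
      refine congrArg (fun φ : pullback (sndMap γ) (inr S T) →[G] X.prod (S.sum T) =>
        (Tensor.mk φ _ : Tensor (X.prod (S.sum T)) M.toCoeffSystem)) ?_
      exact MulActionHom.ext fun p => Prod.ext rfl (Subtype.property p).symm
    rw [e1, e2, ← Tensor.mk_add, M.decomp]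
    · intro p q h
      exact Subtype.ext (Prod.ext h (Sum.inl_injective
        (p.2.symm.trans ((congrArg (sndMap γ) h).trans q.2))))
    · intro p q h
      exact Subtype.ext (Prod.ext h (Sum.inr_injective
        (p.2.symm.trans ((congrArg (sndMap γ) h).trans q.2))))
    · intro p q h
      exact Sum.inl_ne_inr (p.2.symm.trans ((congrArg (sndMap γ) h).trans q.2))
    · intro d
      rcases hd : (sndMap γ d : S ⊕ T) with s | t
      · exact Or.inl ⟨⟨(d, s), hd⟩, rfl⟩
      · exact Or.inr ⟨⟨(d, t), hd⟩, rfl⟩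

/-- The topological Mackey functor `X ⊗ M`. -/
def tensorObj (X : GSpace G) (M : MackeyFunctor.{u, w} G) :
    TopMackeyFunctor.{u, max (u + 1) w} G where
  obj S := Tensor (X.prod S) M.toCoeffSystem
  cov := tensorCov M
  cov_id S x := by
    induction x using Tensor.ind with | h C γ c
    rfl
  cov_comp f g x := by
    induction x using Tensor.ind with | h C γ c
    rfl
  cov_sum S T := (tensor_sum M S T).1
  contra := tensorContra M
  contra_id := tensorContra_id M
  contra_comp := tensorContra_comp M
  contra_sum S T := (tensor_sum M S T).2
  base_change := tensor_base_change M
  top S := inferInstance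
  ktop S := inferInstance
  continuous_cov _ := Tensor.continuous_map _ _
  continuous_contra := continuous_tensorContra M

/-- The morphism `X ⊗ M → Y ⊗ N` induced by `X → Y` and `M → N`. -/
def tensorMap {X Y : GSpace G} {M N : MackeyFunctor.{u, w} G} (f : X ⟶ Y) (a : M ⟶ N) :
    tensorObj X M ⟶ tensorObj Y N where
  app S := Tensor.map (GSpace.prodMap f (MulActionHom.id G)) (MackeyFunctor.Hom.toHom a)
  app_cov g x := by
    induction x using Tensor.ind with | h C γ c
    rfl
  app_contra {S T} g x := by
    induction x using Tensor.ind with | h C γ c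
    refine congrArg (Tensor.mk (X := Y.prod S) (k := N.toCoeffSystem) _) ?_
    exact MackeyFunctor.Hom.app_contra a _ c
  cont S := Tensor.continuous_map _ _

/-- The functor `(X, M) ↦ X ⊗ M` from `G`-spaces and Mackey functors to topological Mackey
functors. -/
def tensor (G : Type u) [Group G] :
    GSpace G × MackeyFunctor.{u, w} G ⥤ TopMackeyFunctor.{u, max (u + 1) w} G where
  obj P := tensorObj P.1 P.2
  map F := tensorMap F.1 F.2
  map_id P := by
    apply TopMackeyFunctor.Hom.ext
    funext S
    refine AddMonoidHom.ext fun x => ?_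
    induction x using Tensor.ind with | h C γ c
    rfl
  map_comp F F' := by
    apply TopMackeyFunctor.Hom.ext
    funext S
    refine AddMonoidHom.ext fun x => ?_
    induction x using Tensor.ind with | h C γ c
    rfl

end TensorMackey

/-! ### The topological `G`-module `X ⊗_F A` -/

section TensorF

variable {G : Type u} [Group G]

/-- The covariant functor `S ↦ Hom(S, A)` on finite sets, where a map acts by summation over its
fibres. Finite sets are regarded as finite sets with an action of the trivial group. -/
def homCoeff (A : Type u) [AddCommGroup A] : CoeffSystem.{u, u} PUnit.{u + 1} where
  obj S := S → A
  cov {S T} f := AddMonoidHom.mk' (transfer (f : S → T)) (transfer_add _)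
  cov_id _ x := transfer_id x
  cov_comp f g x := transfer_comp f g x
  cov_sum S T := by
    refine (biproduct_bijective (i := AddMonoidHom.mk' (transfer (inl S T)) (transfer_add _))
      (j := AddMonoidHom.mk' (transfer (inr S T)) (transfer_add _))
      (p := AddMonoidHom.mk' (fun (ψ : S.sum T → A) s => ψ (inl S T s)) fun _ _ => rfl)
      (q := AddMonoidHom.mk' (fun (ψ : S.sum T → A) s => ψ (inr S T s)) fun _ _ => rfl)
      ?_ ?_ ?_ ?_ ?_).1
    · exact fun x => funext fun s => transfer_injective Sum.inl_injective x s
    · exact fun x => funext fun s => transfer_injective Sum.inr_injective x s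
    · exact fun x => funext fun s => transfer_eq_zero (fun _ => Sum.inr_ne_inl) x
    · exact fun x => funext fun s => transfer_eq_zero (fun _ => Sum.inl_ne_inr) x
    · refine transfer_decomp Sum.inl_injective Sum.inr_injective (fun _ _ => Sum.inl_ne_inr) ?_
      rintro (s | s)
      · exact Or.inl ⟨s, rfl⟩
      · exact Or.inr ⟨s, rfl⟩

/-- The functoriality of `Hom(S, A)` in `A`. -/
def homCoeffMap {A B : Type u} [AddCommGroup A] [AddCommGroup B] (a : A →+ B) :
    CoeffSystem.Hom (homCoeff A) (homCoeff B) where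
  app S := AddMonoidHom.mk' (fun (ψ : S → A) s => a (ψ s)) fun ψ χ =>
    funext fun s => map_add a (ψ s) (χ s)
  app_cov {S T} f x := funext fun t => map_transfer a (f : S → T) x t

/-- A continuous map of underlying spaces. -/
def GSpace.underlyingMap {X Y : GSpace G} (f : X → Y) (hf : Continuous f) :
    X.underlying ⟶ Y.underlying where
  map := ⟨f, fun _ _ => rfl⟩
  cont := hf

/-- The topological abelian group `X ⊗_F A`: the coend of `S ↦ Map(S, X)` and `S ↦ Hom(S, A)` over
finite sets. -/
abbrev TensorF (X : GSpace G) (A : Type u) [AddCommGroup A] : Type (u + 1) :=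
  Tensor X.underlying (homCoeff A)

/-- The diagonal action of `G` on `X ⊗_F A`. -/
instance tensorFAction (X : GSpace G) (A : GModule.{u, u} G) :
    DistribMulAction G (TensorF X A) where
  smul g := Tensor.map (GSpace.underlyingMap (fun x : X => g • x) (X.continuous_smul g))
    (homCoeffMap (DistribSMul.toAddMonoidHom A g))
  one_smul x := by
    induction x using Tensor.ind with | h S φ κ
    exact Tensor.mk_congr (fun s => one_smul G (α := X) _) (funext fun s => one_smul G (α := A) _)
  mul_smul g h x := by
    induction x using Tensor.ind with | h S φ κ
    exact Tensor.mk_congr (fun s => mul_smul (β := X) g h _)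
      (funext fun s => mul_smul (β := A) g h _)
  smul_zero g := map_zero (Tensor.map _ _)
  smul_add g := map_add (Tensor.map _ _)

/-- The topological `G`-module `X ⊗_F A`. -/
def tensorFObj (X : GSpace G) (A : GModule.{u, u} G) : TopGModule.{u, u + 1} G where
  carrier := TensorF X A
  continuous_smul _ := Tensor.continuous_map _ _

/-- The homomorphism `X ⊗_F A → Y ⊗_F B` induced by `X → Y` and `A → B`. -/
def tensorFMap {X Y : GSpace G} {A B : GModule.{u, u} G} (f : GSpace.Hom X Y) (a : A →+[G] B) :
    tensorFObj X A ⟶ tensorFObj Y B where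
  map :=
    { toFun := Tensor.map (GSpace.underlyingMap f.map f.cont) (homCoeffMap a.toAddMonoidHom)
      map_zero' := map_zero (Tensor.map _ _)
      map_add' := map_add (Tensor.map _ _)
      map_smul' := fun g x => by
        induction x using Tensor.ind with | h S φ κ
        exact Tensor.mk_congr (fun s => map_smul f.map g _) (funext fun s => map_smul a g _) }
  cont := Tensor.continuous_map _ _

/-- The functor `(X, A) ↦ X ⊗_F A` from `G`-spaces and `G`-modules to topological `G`-modules. -/
def tensorF (G : Type u) [Group G] :
    GSpace G × GModule.{u, u} G ⥤ TopGModule.{u, u + 1} G where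
  obj P := tensorFObj P.1 P.2
  map F := tensorFMap F.1 F.2
  map_id P := by
    apply TopGModule.Hom.ext
    refine DistribMulActionHom.ext fun x => ?_
    induction x using Tensor.ind with | h C γ c
    rfl
  map_comp F F' := by
    apply TopGModule.Hom.ext
    refine DistribMulActionHom.ext fun x => ?_
    induction x using Tensor.ind with | h C γ c
    rfl

end TensorF

/-! ### Cokernels -/

section Coker

variable {G : Type u} [Group G]

namespace TopMackeyFunctor

variable {P Q : TopMackeyFunctor.{u, w} G} (f : TopMackeyFunctor.Hom P Q)

/-- The covariant functoriality of the cokernel. -/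
def cokerCov {S T : FinGSet G} (g : S →[G] T) :
    Q.obj S ⧸ (f.app S).range →+ Q.obj T ⧸ (f.app T).range :=
  QuotientAddGroup.map _ _ (Q.cov g) (by
    rintro _ ⟨x, rfl⟩
    exact ⟨P.cov g x, f.app_cov g x⟩)

/-- The contravariant functoriality of the cokernel. -/
def cokerContra {S T : FinGSet G} (g : S →[G] T) :
    Q.obj T ⧸ (f.app T).range →+ Q.obj S ⧸ (f.app S).range :=
  QuotientAddGroup.map _ _ (Q.contra g) (by
    rintro _ ⟨x, rfl⟩
    exact ⟨P.contra g x, f.app_contra g x⟩)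

theorem coker_base_change {A B C D : FinGSet G} {g : A →[G] B} {h : A →[G] C} {i : B →[G] D}
    {k : C →[G] D} (hp : IsPB g h i k) (x : Q.obj C ⧸ (f.app C).range) :
    cokerContra f i (cokerCov f k x) = cokerCov f g (cokerContra f h x) := by
  induction x using QuotientAddGroup.induction_on with | H x
  exact congrArg _ (Q.base_change hp x)

theorem coker_sum (S T : FinGSet G) :
    (Function.Bijective fun p : (Q.obj S ⧸ (f.app S).range) × (Q.obj T ⧸ (f.app T).range) =>
      cokerCov f (inl S T) p.1 + cokerCov f (inr S T) p.2) ∧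
      Function.Bijective fun x : Q.obj (S.sum T) ⧸ (f.app (S.sum T)).range =>
        (cokerContra f (inl S T) x, cokerContra f (inr S T) x) := by
  refine sum_bijective (obj := fun S : FinGSet G => Q.obj S ⧸ (f.app S).range)
    (cov := cokerCov f) (contra := cokerContra f) ?_ ?_ (coker_base_change f) ?_ ?_ S T
  · intro S x
    induction x using QuotientAddGroup.induction_on with | H x
    exact congrArg _ (Q.cov_id S x)
  · intro S x
    induction x using QuotientAddGroup.induction_on with | H x
    exact congrArg _ (Q.contra_id S x)
  · intro S hS x
    induction x using QuotientAddGroup.induction_on with | H x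
    exact congrArg _ (Q.eq_zero_of_isEmpty S hS x)
  · intro S T x
    induction x using QuotientAddGroup.induction_on with | H x
    refine congrArg (QuotientAddGroup.mk (s := (f.app (S.sum T)).range)) (Q.decomp
      Sum.inl_injective Sum.inr_injective (fun _ _ => Sum.inl_ne_inr) ?_ x)
    rintro (s | s)
    · exact Or.inl ⟨s, rfl⟩
    · exact Or.inr ⟨s, rfl⟩

/-- The cokernel of a morphism of topological Mackey functors: the quotients by the images, with the
quotient topologies. -/
def coker : TopMackeyFunctor.{u, w} G where
  obj S := Q.obj S ⧸ (f.app S).range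
  cov := cokerCov f
  cov_id S x := by
    induction x using QuotientAddGroup.induction_on with | H x
    exact congrArg _ (Q.cov_id S x)
  cov_comp g h x := by
    induction x using QuotientAddGroup.induction_on with | H x
    exact congrArg _ (Q.cov_comp g h x)
  cov_sum S T := (coker_sum f S T).1
  contra := cokerContra f
  contra_id S x := by
    induction x using QuotientAddGroup.induction_on with | H x
    exact congrArg _ (Q.contra_id S x)
  contra_comp g h x := by
    induction x using QuotientAddGroup.induction_on with | H x
    exact congrArg _ (Q.contra_comp g h x)
  contra_sum S T := (coker_sum f S T).2
  base_change := coker_base_change f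
  top S := inferInstance
  ktop S := inferInstance
  continuous_cov g := continuous_quotientMap _ (Q.continuous_cov g)
  continuous_contra g := continuous_quotientMap _ (Q.continuous_contra g)

/-- The projection to the cokernel. -/
def cokerProj : TopMackeyFunctor.Hom Q (coker f) where
  app S := QuotientAddGroup.mk' (f.app S).range
  app_cov _ _ := rfl
  app_contra _ _ := rfl
  cont S := continuous_quotient_mk' (s := QuotientAddGroup.leftRel (f.app S).range)

theorem cokerProj_surjective (S : FinGSet G) : Function.Surjective ((cokerProj f).app S) :=
  QuotientAddGroup.mk'_surjective _

/-- The map of cokernels induced by a commutative square. -/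
def cokerMap {P' Q' : TopMackeyFunctor.{u, w} G} {f : TopMackeyFunctor.Hom P Q}
    {f' : TopMackeyFunctor.Hom P' Q'} (a : TopMackeyFunctor.Hom P P')
    (b : TopMackeyFunctor.Hom Q Q') (h : ∀ S x, b.app S (f.app S x) = f'.app S (a.app S x)) :
    coker f ⟶ coker f' where
  app S := QuotientAddGroup.map (f.app S).range (f'.app S).range (b.app S) (by
    rintro _ ⟨x, rfl⟩
    exact ⟨a.app S x, (h S x).symm⟩)
  app_cov {S T} g x := by
    obtain ⟨x, rfl⟩ := cokerProj_surjective f S x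
    exact congrArg ((cokerProj f').app T) (b.app_cov g x)
  app_contra {S T} g x := by
    obtain ⟨x, rfl⟩ := cokerProj_surjective f T x
    exact congrArg ((cokerProj f').app S) (b.app_contra g x)
  cont S := continuous_quotientMap _ (b.cont S)

end TopMackeyFunctor

namespace TopGModule

variable {A B : TopGModule.{u, v} G} (f : TopGModule.Hom A B)

/-- The image of a homomorphism of topological modules. -/
abbrev range : AddSubgroup B := f.map.toAddMonoidHom.range

/-- The action on the quotient by the image. -/
instance cokerAction : DistribMulAction G (B ⧸ range f) where
  smul g := QuotientAddGroup.map (range f) (range f) (DistribSMul.toAddMonoidHom B g) (by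
    rintro _ ⟨x, rfl⟩
    exact ⟨g • x, map_smul f.map g x⟩)
  one_smul x := by
    induction x using QuotientAddGroup.induction_on with | H x
    exact congrArg _ (one_smul G x)
  mul_smul g h x := by
    induction x using QuotientAddGroup.induction_on with | H x
    exact congrArg _ (mul_smul g h x)
  smul_zero g := map_zero (QuotientAddGroup.map _ _ _ _)
  smul_add g := map_add (QuotientAddGroup.map _ _ _ _)

/-- The cokernel of a homomorphism of topological modules, with the quotient topology. -/
def coker : TopGModule.{u, v} G where
  carrier := B ⧸ range f
  continuous_smul g := continuous_quotientMap (f := DistribSMul.toAddMonoidHom B g) _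
    (B.continuous_smul g)

/-- The projection to the cokernel. -/
def cokerProj : TopGModule.Hom B (coker f) where
  map :=
    { toFun := QuotientAddGroup.mk' (range f)
      map_zero' := rfl
      map_add' := fun _ _ => rfl
      map_smul' := fun _ _ => rfl }
  cont := continuous_quotient_mk' (s := QuotientAddGroup.leftRel (range f))

theorem cokerProj_surjective : Function.Surjective (cokerProj f).map :=
  QuotientAddGroup.mk'_surjective _

theorem range_le_comap {A' B' : TopGModule.{u, v} G} {f : TopGModule.Hom A B}
    {f' : TopGModule.Hom A' B'} (a : TopGModule.Hom A A') (b : TopGModule.Hom B B')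
    (h : ∀ x, b.map (f.map x) = f'.map (a.map x)) :
    range f ≤ (range f').comap b.map.toAddMonoidHom := by
  rintro _ ⟨x, rfl⟩
  exact ⟨a.map x, (h x).symm⟩

/-- The map of cokernels induced by a commutative square. -/
def cokerMap {A' B' : TopGModule.{u, v} G} {f : TopGModule.Hom A B} {f' : TopGModule.Hom A' B'}
    (a : TopGModule.Hom A A') (b : TopGModule.Hom B B')
    (h : ∀ x, b.map (f.map x) = f'.map (a.map x)) : coker f ⟶ coker f' where
  map :=
    { toFun := QuotientAddGroup.map (range f) (range f') b.map.toAddMonoidHom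
        (range_le_comap a b h)
      map_zero' := map_zero (QuotientAddGroup.map _ _ _ _)
      map_add' := map_add (QuotientAddGroup.map _ _ _ _)
      map_smul' := fun g x => by
        obtain ⟨x, rfl⟩ := cokerProj_surjective f x
        exact congrArg (cokerProj f').map (map_smul b.map g x) }
  cont := continuous_quotientMap (range_le_comap a b h) b.cont

end TopGModule

end Coker

/-! ### The reduced constructions -/

section Reduced

/-- The functor `(X, M) ↦ coker (x₀ ⊗ M → X ⊗ M)` from based `G`-spaces and Mackey functors to
topological Mackey functors. -/
def redTensor (G : Type u) [Group G] :
    BasedGSpace G × MackeyFunctor.{u, w} G ⥤ TopMackeyFunctor.{u, max (u + 1) w} G where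
  obj P := TopMackeyFunctor.coker (tensorMap P.1.incl (𝟙 P.2))
  map {P Q} F := TopMackeyFunctor.cokerMap (tensorMap (𝟙 (GSpace.point G)) F.2)
    (tensorMap (BasedGSpace.Hom.map F.1) F.2)
    (fun S x => by
      induction x using Tensor.ind with | h C γ c
      exact Tensor.mk_congr (fun s => Prod.ext (BasedGSpace.Hom.map_pt F.1) rfl) rfl)
  map_id P := by
    apply TopMackeyFunctor.Hom.ext
    funext S
    refine AddMonoidHom.ext fun x => ?_
    obtain ⟨x, rfl⟩ := TopMackeyFunctor.cokerProj_surjective _ S x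
    induction x using Tensor.ind with | h C γ c
    rfl
  map_comp F F' := by
    apply TopMackeyFunctor.Hom.ext
    funext S
    refine AddMonoidHom.ext fun x => ?_
    obtain ⟨x, rfl⟩ := TopMackeyFunctor.cokerProj_surjective _ S x
    induction x using Tensor.ind with | h C γ c
    rfl

/-- The natural projection from `X ⊗ M` to its reduced version. -/
def tensorProj (G : Type u) [Group G] :
    (BasedGSpace.forget G).prod (𝟭 (MackeyFunctor.{u, w} G)) ⋙ tensor G ⟶ redTensor G where
  app P := TopMackeyFunctor.cokerProj (tensorMap P.1.incl (𝟙 P.2))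
  naturality _ _ _ := rfl

/-- The functor `(X, A) ↦ coker (x₀ ⊗_F A → X ⊗_F A)` from based `G`-spaces and `G`-modules to
topological `G`-modules. -/
def redTensorF (G : Type u) [Group G] :
    BasedGSpace G × GModule.{u, u} G ⥤ TopGModule.{u, u + 1} G where
  obj P := TopGModule.coker (tensorFMap P.1.incl (𝟙 P.2))
  map {P Q} F := TopGModule.cokerMap (tensorFMap (𝟙 (GSpace.point G)) F.2)
    (tensorFMap (BasedGSpace.Hom.map F.1) F.2)
    (fun x => by
      induction x using Tensor.ind with | h C γ c
      exact Tensor.mk_congr (fun s => BasedGSpace.Hom.map_pt F.1) rfl)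
  map_id P := by
    apply TopGModule.Hom.ext
    refine DistribMulActionHom.ext fun x => ?_
    obtain ⟨x, rfl⟩ := TopGModule.cokerProj_surjective _ x
    induction x using Tensor.ind with | h C γ c
    rfl
  map_comp F F' := by
    apply TopGModule.Hom.ext
    refine DistribMulActionHom.ext fun x => ?_
    obtain ⟨x, rfl⟩ := TopGModule.cokerProj_surjective _ x
    induction x using Tensor.ind with | h C γ c
    rfl

/-- The natural projection from `X ⊗_F A` to its reduced version. -/
def tensorFProj (G : Type u) [Group G] :
    (BasedGSpace.forget G).prod (𝟭 (GModule.{u, u} G)) ⋙ tensorF G ⟶ redTensorF G where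
  app P := TopGModule.cokerProj (tensorFMap P.1.incl (𝟙 P.2))
  naturality _ _ _ := rfl

end Reduced

end

end MackeyTensor

open MackeyTensor

namespace MackeyTensor

noncomputable section

open FinGSet

/-! ### Equalizers of maps into weak Hausdorff spaces -/

/-! An element of `Y ⊗_F A` is a formal finite sum of points of `Y` with coefficients in `A`:
summing `κ` over the fibres of `φ` assigns to `[φ, κ]` a function `Y → A` (`density`), and pushing
`[φ, κ]` forward to the image of `φ` shows that this function determines the class. In the same way
`[γ, c] ↦ [γ^H, c]` (`fixedTensor`) is an injection of the coend of a `G`-space `Z` with `R A` into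
`Z^H ⊗_F A`. Its image consists of the elements with `WH`-equivariant coefficients: as `G` is
finite, the orbits of the support form a finite `G`-set `U` in `Z`, and an equivariant coefficient
function restricts to an element of `R A (U)`. For `Z = X × S` one has `Z^H = X^H × S^H` with `S^H`
finite and discrete, so such elements correspond to equivariant maps `S^H → X^H ⊗_F A`. This is the
bijection `rhoApp`.

The topological content is that `fixedTensor` is a closed map (`isClosedMap_fixedTensor`).
Closedness in the coend is tested on families `[f k, a]` with `k` in a compact Hausdorff space. Only
finitely many patterns of coincidences `g • f k d = g' • f k d'` occur. For a fixed pattern the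
preimage of `[f k, a]` is written with one finite `G`-set, one coefficient and a map to `Z` that
varies continuously with `k`. Passing to a limit can only create further coincidences, because
equalizers of maps into weak Hausdorff spaces are closed; hence the family still makes sense on a
closed set. Splitting `(X × S)^H ⊗_F A` into components and reassembling them are continuous, so
`rhoApp` is a homeomorphism.

In the reduced case the constant map at the base point splits the cokernel of `y₀ ⊗_F A → X^H ⊗_F A`
as a topological module. Hence an equivariant map into the cokernel lifts continuously to `X^H ⊗_F
A`, where `rhoApp` can be inverted. -/

theorem isClosed_image_of_weakHausdorff {K : Type u} {Y : Type v} [TopologicalSpace K]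
    [CompactSpace K] [T2Space K] [TopologicalSpace Y] [WeakHausdorff.{u} Y] {f : K → Y}
    (hf : Continuous f) {C : Set K} (hC : IsClosed C) : IsClosed (f '' C) := by
  have : CompactSpace C := isCompact_iff_compactSpace.1 hC.isCompact
  have h := WeakHausdorff.isClosed_range.{u} (CompHaus.of C)
    (⟨fun k => f k.1, hf.comp continuous_subtype_val⟩ : C(C, Y))
  convert h using 1
  ext y
  simp [Set.mem_range]

theorem isClosed_singleton_of_weakHausdorff {Y : Type v} [TopologicalSpace Y]
    [WeakHausdorff.{u} Y] (y : Y) : IsClosed {y} := by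
  have h := isClosed_image_of_weakHausdorff (K := PUnit.{u + 1}) (f := fun _ => y)
    continuous_const isClosed_univ
  simpa using h

/-- Two maps from a compact Hausdorff space to a weak Hausdorff space agree on a closed set. -/
theorem isClosed_eq_of_weakHausdorff {K : Type u} {Y : Type v} [TopologicalSpace K]
    [CompactSpace K] [T2Space K] [TopologicalSpace Y] [WeakHausdorff.{u} Y] {f g : K → Y}
    (hf : Continuous f) (hg : Continuous g) : IsClosed {k | f k = g k} := by
  rw [← isOpen_compl_iff, isOpen_iff_forall_mem_open]
  intro k₀ hk₀
  -- Both maps are combined into one map on `K ⊕ K`, so that a fibre records the preimages under `f`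
  -- and under `g` together.
  have hh : Continuous (Sum.elim f g) := hf.sumElim hg
  have hd : Disjoint (Sum.elim f g ⁻¹' {f k₀}) (Sum.elim f g ⁻¹' {g k₀}) := by
    rw [Set.disjoint_left]
    intro x h1 h2
    exact hk₀ (h1.symm.trans h2)
  obtain ⟨U, V, hU, hV, hfU, hgV, hUV⟩ := normal_separation
    ((isClosed_singleton_of_weakHausdorff.{u} (f k₀)).preimage hh)
    ((isClosed_singleton_of_weakHausdorff.{u} (g k₀)).preimage hh) hd
  -- The complement of the image of `Uᶜ` consists of the points whose whole fibre lies in `U`. A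
  -- common value `f k = g k` in both such sets would have its fibre in `U` and in `V`, which are
  -- disjoint.
  have hO := (isClosed_image_of_weakHausdorff hh hU.isClosed_compl).isOpen_compl
  have hO' := (isClosed_image_of_weakHausdorff hh hV.isClosed_compl).isOpen_compl
  refine ⟨_, ?_, (hO.preimage hf).inter (hO'.preimage hg), ?_, ?_⟩
  · rintro k ⟨h1, h2⟩ (hk : f k = g k)
    have h1' : Sum.inl k ∈ U := by
      by_contra h
      exact h1 ⟨Sum.inl k, h, rfl⟩
    have h2' : Sum.inl k ∈ V := by
      by_contra h
      exact h2 ⟨Sum.inl k, h, hk⟩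
    exact Set.disjoint_left.1 hUV h1' h2'
  · rintro ⟨x, hx, e⟩
    exact hx (hfU e)
  · rintro ⟨x, hx, e⟩
    exact hx (hgV e)

/-! ### Finite invariant subsets -/

theorem smul_eq_of_subsingleton {E : Type u} [Group E] [Subsingleton E] {S : Type v}
    [MulAction E S] (g : E) (s : S) : g • s = s := by
  rw [Subsingleton.elim g 1, one_smul]

/-- The equivariant maps from a finite `G`-set to a `G`-space. -/
abbrev FinGSet.Maps {G : Type u} [Group G] (S : FinGSet G) (X : GSpace G) : Type u := S →[G] X

/-- The equivariant maps between two finite `G`-sets. -/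
abbrev FinGSet.Hom {G : Type u} [Group G] (S T : FinGSet G) : Type u := S →[G] T

/-- A map of sets, as an equivariant map for a trivial group. -/
def plainMaps {E : Type u} [Group E] [Subsingleton E] {S : FinGSet E} {X : GSpace E} (f : S → X) :
    S.Maps X :=
  ⟨f, fun g s => by rw [smul_eq_of_subsingleton, id, smul_eq_of_subsingleton]⟩

/-- A map of sets, as an equivariant map for a trivial group. -/
def plainHom {E : Type u} [Group E] [Subsingleton E] {S T : FinGSet E} (f : S → T) : S.Hom T :=
  ⟨f, fun g s => by rw [smul_eq_of_subsingleton, id, smul_eq_of_subsingleton]⟩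

/-- A finite set, with the action of the trivial group. -/
def FinGSet.trivial (S : Type u) [Finite S] : FinGSet PUnit.{u + 1} :=
  letI : MulAction PUnit.{u + 1} S :=
    { smul := fun _ x => x
      one_smul := fun _ => rfl
      mul_smul := fun _ _ _ => rfl }
  ⟨S⟩

section Invariant

variable {G : Type u} [Group G] {Y : Type u} [MulAction G Y]

/-- A finite invariant subset of a set with an action of `G`. -/
def FinGSet.ofInvariant (U : Set Y) (hf : U.Finite) (hU : ∀ (g : G), ∀ y ∈ U, g • y ∈ U) :
    FinGSet G :=
  letI : MulAction G U :=
    { smul := fun g y => ⟨g • y.1, hU g y.1 y.2⟩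
      one_smul := fun y => Subtype.ext (one_smul G y.1)
      mul_smul := fun g h y => Subtype.ext (mul_smul g h y.1) }
  haveI : Finite U := hf
  ⟨U⟩

/-- The inclusion of an invariant subset. -/
def FinGSet.inclusion (U : Set Y) (hf : U.Finite) (hU : ∀ (g : G), ∀ y ∈ U, g • y ∈ U) :
    ofInvariant U hf hU →[G] Y :=
  ⟨Subtype.val, fun _ _ => rfl⟩

variable {X : GSpace G} {S : FinGSet G} (φ : S.Maps X)

/-- The range of an equivariant map. -/
def FinGSet.rangeSet : FinGSet G :=
  ofInvariant (Set.range φ) (Set.finite_range φ) (by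
    rintro g _ ⟨s, rfl⟩
    exact ⟨g • s, map_smul φ g s⟩)

/-- The inclusion of the range. -/
def FinGSet.rangeInclusion : (rangeSet φ).Maps X := inclusion _ _ _

/-- The corestriction of an equivariant map to its range. -/
def FinGSet.toRange : S.Hom (rangeSet φ) :=
  ⟨fun s => ⟨φ s, s, rfl⟩, fun g s => Subtype.ext (map_smul φ g s)⟩

theorem FinGSet.rangeInclusion_injective : Function.Injective (rangeInclusion φ) :=
  Subtype.val_injective

end Invariant

/-! ### Coefficients of elements of `Y ⊗_F A` -/

/-- The classes `[φ, κ]` depend additively on `κ`. -/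
def Tensor.mkHom {G : Type u} [Group G] {X : GSpace G} {k : CoeffSystem.{u, w} G} {S : FinGSet G}
    (φ : S →[G] X) : k.obj S →+ Tensor X k :=
  AddMonoidHom.mk' (Tensor.mk φ) (Tensor.mk_add φ)

section Density

variable {A B : Type u} [AddCommGroup A] [AddCommGroup B] {X Y : GSpace PUnit.{u + 1}}

/-- The coefficients of an element of `Y ⊗_F A`, as a formal sum of points of `Y`. -/
def density (Y : GSpace PUnit.{u + 1}) (A : Type u) [AddCommGroup A] :
    Tensor Y (homCoeff A) →+ (Y → A) :=
  Tensor.lift (fun S φ => AddMonoidHom.mk' (fun κ : S → A => transfer φ κ) (transfer_add _))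
    fun f φ κ => transfer_comp f φ κ

theorem transfer_comp_injective {S T U : Type*} [Finite S] {f : T → U}
    (hf : Function.Injective f) (φ : S → T) (ψ : S → A) (t : T) :
    transfer (fun s => f (φ s)) ψ (f t) = transfer φ ψ t := by
  unfold transfer
  congr 1
  ext s
  simp [hf.eq_iff]

/-- Gluing along the corestriction of `φ` to its image replaces `φ` by an injective map. The new
coefficient at a point of the image is the value of the density there, so it vanishes with the
density. -/
theorem density_injective : Function.Injective (density Y A) := by
  rw [injective_iff_map_eq_zero]
  intro x hx
  induction x using Tensor.ind with | h S φ κ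
  have e := Tensor.glue (X := Y) (k := homCoeff A) (toRange φ) (rangeInclusion φ) κ
  refine e.trans (Eq.trans (congrArg _ ?_) (Tensor.mk_zero _))
  funext t
  exact (transfer_comp_injective (rangeInclusion_injective φ) (toRange φ) κ t).symm.trans
    (congrFun hx _)

/-- An injective map merges no points, so no coefficients are added together. This applies to
translations by group elements and to the inclusions of `X^H` into `(X × S)^H`. -/
theorem density_map_of_injective {f : X ⟶ Y} (hf : Function.Injective (GSpace.Hom.map f))
    (a : A →+ B) (x : Tensor X (homCoeff A)) (y : X) :
    density Y B (Tensor.map f (homCoeffMap a) x) (GSpace.Hom.map f y) = a (density X A x y) := by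
  induction x using Tensor.ind with | h S φ κ
  exact (transfer_comp_injective hf φ _ y).trans (map_transfer a φ κ y).symm

theorem density_map_of_notMem {f : X ⟶ Y} {y : Y} (hy : ∀ x, GSpace.Hom.map f x ≠ y) (a : A →+ B)
    (x : Tensor X (homCoeff A)) : density Y B (Tensor.map f (homCoeffMap a) x) y = 0 := by
  induction x using Tensor.ind with | h S φ κ
  exact transfer_eq_zero (fun s => hy (φ s)) _

end Density

section DensityAction

variable {G : Type u} [Group G] {Y : GSpace G} {A : GModule.{u, u} G}

theorem density_smul (g : G) (x : TensorF Y A) (y : Y) :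
    density Y.underlying A (g • x) (g • y) = g • density Y.underlying A x y :=
  density_map_of_injective
    (f := GSpace.underlyingMap (fun x : Y => g • x) (Y.continuous_smul g))
    (fun _ _ h => smul_left_cancel (α := G) (β := Y) g h) (DistribSMul.toAddMonoidHom A g) x y

end DensityAction

/-! ### From `Z ⊗ R A` to `Z^H ⊗_F A` -/

section FixedTensor

variable {G : Type u} [Group G] (H : Subgroup G) (Z : GSpace G) (A : GModule.{u, u} (Weyl H))

/-- The finite set `S^H`. -/
abbrev fixedSet (S : FinGSet G) : FinGSet PUnit.{u + 1} := trivial (Fixed H S)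

/-- The space `Z^H`, without the action of the Weyl group. -/
abbrev fixedSpace (Z : GSpace G) : GSpace PUnit.{u + 1} := ((GSpace.fixed H).obj Z).underlying

/-- The map of `H`-fixed points, without the action of the Weyl group. -/
def fixedMaps {Z : GSpace G} {S : FinGSet G} (γ : S.Maps Z) :
    (fixedSet H S).Maps (fixedSpace H Z) :=
  plainMaps (fun s : Fixed H S => fixedMap H γ s)

/-- The map of `H`-fixed points of finite sets, without the action of the Weyl group. -/
def fixedSetMap {S T : FinGSet G} (f : S →[G] T) : (fixedSet H S).Hom (fixedSet H T) :=
  plainHom (fun s : Fixed H S => fixedMap H f s)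

/-- The underlying function of an equivariant map `S^H → A`. -/
def RObj.fn {S : FinGSet G} : (RObj H A).obj S →+ (homCoeff A).obj (fixedSet H S) :=
  AddMonoidHom.mk' (fun (c : Fixed H S →[Weyl H] A) (s : Fixed H S) => c s) fun _ _ => rfl

/-- The homomorphism `Z ⊗ R A → Z^H ⊗_F A` sending `[γ, c]` to `[γ^H, c]`. -/
def fixedTensor : Tensor Z (RObj H A).toCoeffSystem →+ TensorF ((GSpace.fixed H).obj Z) A :=
  Tensor.lift (fun _ γ => (Tensor.mkHom (fixedMaps H γ)).comp (RObj.fn H A))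
    fun f φ κ => Tensor.glue (fixedSetMap H f) (fixedMaps H φ) (RObj.fn H A κ)

variable {Z A}

theorem continuous_fixedMaps {S : FinGSet G} :
    Continuous (fixedMaps H : S.Maps Z → (fixedSet H S).Maps (fixedSpace H Z)) :=
  continuous_toMap fun s => GSpace.continuous_fixed_mk H (continuous_eval (Fixed.val s))

theorem continuous_fixedTensor : Continuous (fixedTensor H Z A) :=
  Tensor.continuous_of_mk fun _ c =>
    (Tensor.continuous_mk (RObj.fn H A c)).comp (continuous_fixedMaps H)

/-- The coefficients of an element of `Z ⊗ R A` at the points of `Z^H`. -/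
abbrev fixedDensity (x : TensorF ((GSpace.fixed H).obj Z) A) : Fixed H Z → A :=
  density ((GSpace.fixed H).obj Z).underlying A x

theorem fixedDensity_fixedTensor_mk {S : FinGSet G} (γ : S.Maps Z) (c : (RObj H A).obj S) :
    fixedDensity H (fixedTensor H Z A (Tensor.mk γ c)) =
      transfer (fixedMap H γ) (RObj.fn H A c) := rfl

/-- Summing an equivariant function over the fibres of an equivariant map gives an equivariant
function. This necessary condition for lying in the image of `fixedTensor` is also sufficient when
`G` is finite, by `exists_fixedTensor_eq`. -/
theorem fixedDensity_fixedTensor_smul (x : Tensor Z (RObj H A).toCoeffSystem) (g : Weyl H)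
    (z : Fixed H Z) : fixedDensity H (fixedTensor H Z A x) (g • z) =
      g • fixedDensity H (fixedTensor H Z A x) z := by
  induction x using Tensor.ind with | h S γ c
  exact transfer_smul (map_smul (fixedMap H γ)) (MulActionHom.map_smul' c) g z

theorem fixedMap_injective {S T : Type*} [MulAction G S] [MulAction G T] {f : S →[G] T}
    (hf : Function.Injective f) : Function.Injective (fixedMap H f) :=
  fun _ _ h => Fixed.ext (hf (congrArg Fixed.val h))

/-- As for `density_injective`: after pushing forward to the image of `γ`, the coefficient is the
density restricted to the `H`-fixed points of that image. -/
theorem fixedTensor_injective : Function.Injective (fixedTensor H Z A) := by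
  rw [injective_iff_map_eq_zero]
  intro x hx
  induction x using Tensor.ind with | h S γ c
  have e := Tensor.glue (k := (RObj H A).toCoeffSystem) (toRange γ) (rangeInclusion γ) c
  refine e.trans (Eq.trans (congrArg _ ?_) (Tensor.mk_zero _))
  refine MulActionHom.ext fun t => ?_
  have h1 := transfer_comp_injective (fixedMap_injective H (rangeInclusion_injective γ))
    (fixedMap H (toRange γ)) (RObj.fn H A c) t
  exact h1.symm.trans ((congrFun (fixedDensity_fixedTensor_mk H γ c) _).symm.trans
    (congrFun ((congrArg (fixedDensity H) hx).trans (map_zero _)) _))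

/-- The restriction to a finite invariant set of a function on the fixed points. -/
def restrictDensity {U : Set Z} {hf : U.Finite} {hU : ∀ (g : G), ∀ y ∈ U, g • y ∈ U}
    {e : Fixed H Z → A} (he : ∀ (g : Weyl H) z, e (g • z) = g • e z) :
    Fixed H (ofInvariant U hf hU) →[Weyl H] A :=
  ⟨fun z => e (fixedMap H (inclusion U hf hU) z), fun g z => by rw [map_smul, he]; rfl⟩

/-- The coefficients are those of `[φ₀, a]`, but the points are moved by `q` from `φ₀ d` to `φ d`.
With `φ = φ₀` and `q` the inclusion this produces a preimage of `[φ₀, a]`; with `φ` varying it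
produces preimages for a whole family while the finite `G`-set and the coefficient stay fixed. -/
theorem fixedTensor_mk_restrictDensity {U : Set Z} {hf : U.Finite}
    {hU : ∀ (g : G), ∀ y ∈ U, g • y ∈ U} {D : FinGSet PUnit.{u + 1}} {a : D → A}
    {φ₀ φ : D.Maps ((GSpace.fixed H).obj Z).underlying}
    (he : ∀ (g : Weyl H) z, fixedDensity H (Tensor.mk φ₀ a) (g • z) =
      g • fixedDensity H (Tensor.mk φ₀ a) z)
    (hφ₀ : ∀ d, (φ₀ d : Fixed H Z).val ∈ U) {q : ofInvariant U hf hU →[G] Z}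
    (hq : ∀ d, q ⟨_, hφ₀ d⟩ = (φ d : Fixed H Z).val) :
    fixedTensor H Z A (Tensor.mk (k := (RObj H A).toCoeffSystem) q (restrictDensity H he)) =
      Tensor.mk φ a := by
  let p₀ : D → Fixed H (ofInvariant U hf hU) := fun d =>
    ⟨⟨_, hφ₀ d⟩, fun h hh => Subtype.ext ((φ₀ d : Fixed H Z).smul_val h hh)⟩
  let p : D.Hom (fixedSet H (ofInvariant U hf hU)) := plainHom p₀
  -- Since `φ` is the composite of `p` and the map induced by `q`, the class `[φ, a]` glues to one
  -- with coefficient `p_* a`. That coefficient is the restricted density, because `φ₀` is `p`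
  -- followed by an injection.
  refine Eq.trans ?_ ((Tensor.glue (k := homCoeff A) p (fixedMaps H q) a).symm.trans
    (Tensor.mk_congr (fun d => Fixed.ext (hq d)) rfl))
  refine congrArg (Tensor.mk (k := homCoeff A) (fixedMaps H q)) (funext fun z => ?_)
  exact transfer_comp_injective (fixedMap_injective H (f := inclusion U hf hU)
    Subtype.val_injective) p a z

end FixedTensor

/-! ### `Z ⊗ R A → Z^H ⊗_F A` is a closed embedding -/

theorem isClosed_of_finite_cases {K : Type v} [TopologicalSpace K] {R : Type w} [Finite R]
    (r : K → R) {P : Set K}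
    (h : ∀ k₀ ∈ P, ∃ W, IsClosed W ∧ W ⊆ P ∧ ∀ k ∈ P, r k = r k₀ → k ∈ W) : IsClosed P := by
  choose! W hW hWP hPW using h
  -- One representative in `P` is chosen for each of the finitely many values of `r` on `P`; their
  -- sets `W` cover `P`.
  choose k hk hkr using fun i : r '' P => i.2
  have e : P = ⋃ i : r '' P, W (k i) := by
    apply Set.Subset.antisymm
    · intro x hx
      exact Set.mem_iUnion.2 ⟨⟨r x, x, hx, rfl⟩, hPW _ (hk _) x hx (hkr ⟨r x, x, hx, rfl⟩).symm⟩
    · exact Set.iUnion_subset fun i => hWP _ (hk i)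
  rw [e]
  exact isClosed_iUnion_of_finite fun i => hW _ (hk i)

theorem cg_of_compactHausdorff (K : Type u) [TopologicalSpace K] [CompactSpace K] [T2Space K] :
    CG.{u} K :=
  inferInstanceAs (IsGeneratedBy test.{u} (test (CompHaus.of K)))

section Maps

variable {G : Type u} [Group G] {X : GSpace G}

theorem FinGSet.Maps.continuous_apply {S : FinGSet G} {K : Type*} [TopologicalSpace K]
    {f : K → S.Maps X} (hf : Continuous f) (s : S) : Continuous fun k => f k s :=
  (continuous_eval s).comp hf

theorem FinGSet.Maps.continuous_mk {S : FinGSet G} {K : Type*} [TopologicalSpace K] [CG.{u} K]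
    {f : K → S.Maps X} (h : ∀ s, Continuous fun k => f k s) : Continuous f :=
  continuous_toMap h

/-- The coend is a quotient of a disjoint union of compactly generated mapping spaces, so closedness
may be tested along compact Hausdorff families of representatives with a fixed coefficient. -/
theorem Tensor.isClosed_of_mk {k : CoeffSystem.{u, w} G} {C : Set (Tensor X k)}
    (h : ∀ (S : FinGSet G) (κ : k.obj S) (K : CompHaus.{u}) (f : K → S.Maps X), Continuous f →
      IsClosed {t | Tensor.mk (f t) κ ∈ C}) : IsClosed C := by
  refine Tensor.isQuotientMap_mk.isClosed_preimage.1 (isClosed_sigma_iff.2 ?_)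
  rintro ⟨S, κ⟩
  rw [IsGeneratedBy.isClosed_iff (X := test.{u})]
  intro K f
  exact h S κ K f f.continuous

end Maps

/-! ### Equivariant maps on finite unions of orbits -/

section Extend

variable {G : Type u} [Group G] {Z : GSpace G} {D : Type u}

/-- The points of the orbits of a family of points. -/
def orbits (φ : D → Z) : Set Z := Set.range fun p : G × D => p.1 • φ p.2

theorem orbits_finite [Finite G] [Finite D] (φ : D → Z) : (orbits φ).Finite :=
  Set.finite_range _

theorem smul_mem_orbits (φ : D → Z) (g : G) : ∀ z ∈ orbits φ, g • z ∈ orbits φ := by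
  rintro _ ⟨⟨g', d⟩, rfl⟩
  exact ⟨⟨g * g', d⟩, mul_smul g g' (φ d)⟩

theorem mem_orbits (φ : D → Z) (d : D) : φ d ∈ orbits φ := ⟨⟨1, d⟩, one_smul G (φ d)⟩

/-- All relations between the translates of `φ` hold for those of `ψ`. -/
def Subordinate (φ ψ : D → Z) : Prop :=
  ∀ (g g' : G) (d d' : D), g • φ d = g' • φ d' → g • ψ d = g' • ψ d'

/-- Subordination says exactly that `g • φ d ↦ g • ψ d` is well defined, so the arbitrary choice of
`g` and `d` is harmless. -/
theorem Subordinate.smul_choose {φ ψ : D → Z} (h : Subordinate φ ψ) {z : Z} (hz : z ∈ orbits φ)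
    {g : G} {d : D} (e : g • φ d = z) : hz.choose.1 • ψ hz.choose.2 = g • ψ d :=
  h _ _ _ _ (hz.choose_spec.trans e.symm)

/-- The set is an intersection of equalizers, one for each relation satisfied by `φ`. Weak
Hausdorffness enters the proof through this lemma: relations persist in limits, while new ones may
appear. -/
theorem isClosed_subordinate {K : Type u} [TopologicalSpace K] [CompactSpace K] [T2Space K]
    {D : Type u} (φ : D → Z) {ψ : K → D → Z} (hψ : ∀ d, Continuous fun k => ψ k d) :
    IsClosed {k | Subordinate φ (ψ k)} := by
  simp only [Subordinate, Set.ofPred_forall]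
  refine isClosed_iInter fun g => isClosed_iInter fun g' => isClosed_iInter fun d =>
    isClosed_iInter fun d' => isClosed_iInter fun _ => ?_
  exact isClosed_eq_of_weakHausdorff ((Z.continuous_smul g).comp (hψ d))
    ((Z.continuous_smul g').comp (hψ d'))

variable [Finite G] [Finite D]

/-- The finite `G`-set consisting of the orbits of a finite family of points. -/
abbrev orbitSet (φ : D → Z) : FinGSet G :=
  ofInvariant (orbits φ) (orbits_finite φ) (smul_mem_orbits φ)

/-- The equivariant map on the orbits of `φ` that sends `φ` to `ψ`. -/
def Subordinate.extend {φ ψ : D → Z} (h : Subordinate φ ψ) : (orbitSet φ).Maps Z where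
  toFun z := (Subtype.property z).choose.1 • ψ (Subtype.property z).choose.2
  map_smul' := by
    rintro g ⟨_, ⟨⟨g', d⟩, rfl⟩⟩
    refine (h.smul_choose (g := g * g') (d := d) _ (mul_smul g g' (φ d))).trans ?_
    rw [mul_smul]
    exact congrArg (g • ·) (h.smul_choose ⟨⟨g', d⟩, rfl⟩ rfl).symm

theorem Subordinate.extend_apply {φ ψ : D → Z} (h : Subordinate φ ψ) (d : D) :
    h.extend ⟨_, mem_orbits φ d⟩ = ψ d :=
  (h.smul_choose (mem_orbits φ d) (one_smul G (φ d))).trans (one_smul G (ψ d))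

end Extend

section FixedTensor

variable {G : Type u} [Group G] [Finite G] (H : Subgroup G) {Z : GSpace G}
  {A : GModule.{u, u} (Weyl H)}

/-- The elements of `Z^H ⊗_F A` with equivariant coefficients come from `Z ⊗ R A`. -/
theorem exists_fixedTensor_eq (y : TensorF ((GSpace.fixed H).obj Z) A)
    (hy : ∀ (g : Weyl H) z, fixedDensity H y (g • z) = g • fixedDensity H y z) :
    ∃ x, fixedTensor H Z A x = y := by
  induction y using Tensor.ind with | h D φ a
  exact ⟨_, fixedTensor_mk_restrictDensity H (φ₀ := φ) (φ := φ)
    (U := orbits fun d => (φ d : Fixed H Z).val) (hf := orbits_finite _)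
    (hU := smul_mem_orbits _) hy (mem_orbits fun d => (φ d : Fixed H Z).val)
    (q := inclusion _ _ _) fun _ => rfl⟩

/-- The extensions form a continuous family on the closed set where they exist, so a closed
condition on them is closed there and hence in `K`. -/
theorem isClosed_extend {K : Type u} [TopologicalSpace K] [CompactSpace K] [T2Space K]
    {D : Type u} [Finite D] (φ : D → Z) {ψ : K → D → Z} (hψ : ∀ d, Continuous fun k => ψ k d)
    {C : Set ((orbitSet φ).Maps Z)} (hC : IsClosed C) :
    IsClosed {k | ∃ h : Subordinate φ (ψ k), h.extend ∈ C} := by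
  have hV := isClosed_subordinate φ hψ
  have : CompactSpace {k | Subordinate φ (ψ k)} := isCompact_iff_compactSpace.1 hV.isCompact
  have : CG.{u} {k | Subordinate φ (ψ k)} := cg_of_compactHausdorff _
  -- The pair chosen for a point `z` of the orbit set depends on `φ` but not on `k`; evaluation at
  -- `z` is therefore a fixed translate of one coordinate of `ψ k`.
  have hq : Continuous fun k : {k | Subordinate φ (ψ k)} => Subordinate.extend k.2 :=
    continuous_toMap fun z => (Z.continuous_smul _).comp ((hψ _).comp continuous_subtype_val)
  convert hV.isClosedMap_subtype_val _ (hC.preimage hq) using 1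
  ext k
  constructor
  · rintro ⟨h, hk⟩
    exact ⟨⟨k, h⟩, hk, rfl⟩
  · rintro ⟨⟨k, h⟩, hk, rfl⟩
    exact ⟨h, hk⟩

/-- The obstacle is that preimages of `[f k, a]` live on orbit sets that change with `k`. The
parameter space is cut into finitely many pieces by the pattern of coincidences, and on each piece
the orbit set of one member `f k₀` serves for all. -/
theorem isClosedMap_fixedTensor : IsClosedMap (fixedTensor H Z A) := by
  intro C hC
  refine Tensor.isClosed_of_mk fun D a K f hf => ?_
  let ψ : K → D → Z := fun k d => ((f k) d : Fixed H Z).val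
  have hψ : ∀ d, Continuous fun k => ψ k d := fun d =>
    (GSpace.continuous_fixed_val H Z).comp (Maps.continuous_apply hf d)
  -- The pattern of `k` is the set of all relations between translates of its points. There are
  -- finitely many patterns because `G` and `D` are finite.
  refine isClosed_of_finite_cases
    (fun k => {p : (G × G) × D × D | p.1.1 • ψ k p.2.1 = p.1.2 • ψ k p.2.2}) fun k₀ hk₀ => ?_
  -- Membership of `[f k₀, a]` in the image makes its coefficients equivariant. These coefficients
  -- are then used for every subordinate `k`, even where further points of `f k` coincide.
  have he : ∀ (g : Weyl H) z, fixedDensity H (Tensor.mk (k := homCoeff A) (f k₀) a) (g • z) =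
      g • fixedDensity H (Tensor.mk (k := homCoeff A) (f k₀) a) z := by
    obtain ⟨x, -, hx⟩ := hk₀
    intro g z
    have h := fixedDensity_fixedTensor_smul H x g z
    rw [hx] at h
    exact h
  have key : ∀ (k) (h : Subordinate (ψ k₀) (ψ k)), fixedTensor H Z A (Tensor.mk
      (k := (RObj H A).toCoeffSystem) h.extend (restrictDensity H he)) = Tensor.mk (f k) a :=
    fun k h => fixedTensor_mk_restrictDensity H he (mem_orbits (ψ k₀)) h.extend_apply
  refine ⟨_, isClosed_extend (ψ k₀) hψ (hC.preimage (Tensor.continuous_mk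
    (k := (RObj H A).toCoeffSystem) (restrictDensity H he))), ?_, ?_⟩
  · rintro k ⟨h, hk⟩
    exact ⟨_, hk, key k h⟩
  · rintro k ⟨x, hx, hxk⟩ hr
    -- Equal patterns give subordination. Injectivity then identifies the given element of `C` over
    -- `[f k, a]` with the class of the extension.
    have h : Subordinate (ψ k₀) (ψ k) := fun g g' d d' e =>
      (Set.ext_iff.1 hr ((g, g'), d, d')).2 e
    rw [← fixedTensor_injective H ((key k h).trans hxk.symm)] at hx
    exact ⟨h, hx⟩

theorem isClosedEmbedding_fixedTensor : IsClosedEmbedding (fixedTensor H Z A) :=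
  .of_continuous_injective_isClosedMap (continuous_fixedTensor H) (fixedTensor_injective H)
    (isClosedMap_fixedTensor H)

end FixedTensor

/-! ### `(X × S)^H ⊗_F A` and families in `X^H ⊗_F A` indexed by `S^H` -/

/-- This is what makes `component` respect the gluing relation of the coend. -/
theorem transfer_indicator {S T A : Type*} [Finite S] [AddCommGroup A] (f : S → T) (U : Set T)
    (ψ : S → A) : transfer f ((f ⁻¹' U).indicator ψ) = U.indicator (transfer f ψ) := by
  classical
  funext t
  by_cases ht : t ∈ U
  · rw [Set.indicator_of_mem ht]
    refine Finset.sum_congr rfl fun s hs => Set.indicator_of_mem ?_ _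
    have : f s = t := by simpa using hs
    simpa [this] using ht
  · rw [Set.indicator_of_notMem ht]
    refine Finset.sum_eq_zero fun s hs => Set.indicator_of_notMem ?_ _
    have : f s = t := by simpa using hs
    simpa [this] using ht

theorem transfer_indicator_apply {D S T U A : Type*} [Finite D] [AddCommGroup A] {φ : D → S}
    {p : S → T} {q : S → U} {t : T} {r : U} {s : S} (h : ∀ z, z = s ↔ p z = t ∧ q z = r)
    (ψ : D → A) :
    transfer (fun d => p (φ d)) ({d | q (φ d) = r}.indicator ψ) t = transfer φ ψ s := by
  classical
  unfold transfer
  rw [Finset.sum_indicator_eq_sum_filter]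
  refine Finset.sum_congr ?_ fun _ _ => rfl
  ext d
  simp [h (φ d)]

/-- The fibre of `f ∘ q` over `t` is the disjoint union of the fibres of `q` over the points of `f
⁻¹' {t}`. This carries the covariant functoriality of `rhoApp`. -/
theorem indicator_eq_transfer {D S T A : Type*} [Finite S] [AddCommGroup A] (q : D → S) (f : S → T)
    (ψ : D → A) (t : T) :
    {d | f (q d) = t}.indicator ψ = transfer f (fun s => {d | q d = s}.indicator ψ) t := by
  classical
  funext d
  rw [transfer, Finset.sum_apply]
  by_cases hd : f (q d) = t
  · rw [Set.indicator_of_mem (show d ∈ {d | f (q d) = t} from hd), Finset.sum_eq_single (q d)]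
    · exact (Set.indicator_of_mem (s := {d' | q d' = q d}) rfl ψ).symm
    · exact fun s _ hs => Set.indicator_of_notMem (s := {d | q d = s}) (fun h => hs (Eq.symm h)) ψ
    · exact fun h => absurd (by simpa using hd) h
  · rw [Set.indicator_of_notMem (show d ∉ {d | f (q d) = t} from hd)]
    refine (Finset.sum_eq_zero fun s hs => Set.indicator_of_notMem (fun h => hd ?_) _).symm
    have : f s = t := by simpa using hs
    rw [← this]
    exact congrArg f h

section Components

variable {G : Type u} [Group G] (H : Subgroup G) {X : GSpace G} {S : FinGSet G}

/-- The projection `X × S → X`. -/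
def GSpace.prodFstHom (X : GSpace G) (S : FinGSet G) : X.prod S ⟶ X where
  map := ⟨GSpace.prodFst, fun _ _ => rfl⟩
  cont := GSpace.continuous_prodFst

/-- The projection `X × S → S`. -/
def GSpace.prodSndMap (X : GSpace G) (S : FinGSet G) : X.prod S →[G] S :=
  ⟨GSpace.prodSnd, fun _ _ => rfl⟩

/-- The projection `(X × S)^H → X^H`. -/
def fixedFst : Fixed H (X.prod S) → Fixed H X :=
  fixedMap H (GSpace.Hom.map (GSpace.prodFstHom X S))

/-- The projection `(X × S)^H → S^H`. -/
def fixedSnd : Fixed H (X.prod S) → Fixed H S := fixedMap H (GSpace.prodSndMap X S)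

/-- The inclusion of `X^H` into `(X × S)^H` at an element of `S^H`. -/
def fixedPair (s : Fixed H S) (x : Fixed H X) : Fixed H (X.prod S) :=
  ⟨((x.val, s.val) : X × S), fun h hh => Prod.ext (x.smul_val h hh) (s.smul_val h hh)⟩

theorem eq_fixedPair_iff {s : Fixed H S} {x : Fixed H X} (z : Fixed H (X.prod S)) :
    z = fixedPair H s x ↔ fixedFst H z = x ∧ fixedSnd H z = s := by
  constructor
  · rintro rfl
    exact ⟨rfl, rfl⟩
  · rintro ⟨rfl, rfl⟩
    rfl

theorem smul_fixedPair (g : Weyl H) (s : Fixed H S) (x : Fixed H X) :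
    g • fixedPair H s x = fixedPair H (g • s) (g • x) :=
  (eq_fixedPair_iff H _).2 ⟨map_smul (fixedMap H (GSpace.Hom.map (GSpace.prodFstHom X S))) g _,
    map_smul (fixedMap H (GSpace.prodSndMap X S)) g _⟩

theorem fixedPair_injective (s : Fixed H S) :
    Function.Injective (fixedPair H (X := X) s) :=
  fun _ _ h => congrArg (fixedFst H) h

theorem continuous_fixedFst : Continuous (fixedFst H (X := X) (S := S)) :=
  GSpace.Hom.cont ((GSpace.fixed H).map (GSpace.prodFstHom X S))

theorem continuous_fixedPair (s : Fixed H S) : Continuous (fixedPair H (X := X) s) :=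
  GSpace.continuous_fixed_mk H (GSpace.continuous_toProd (GSpace.continuous_fixed_val H X)
    (@continuous_const _ _ _ ⊥ _))

theorem eventually_fixedSnd_eq {K : Type*} [TopologicalSpace K] {f : K → Fixed H (X.prod S)}
    (hf : Continuous f) (k₀ : K) : ∀ᶠ k in nhds k₀, fixedSnd H (f k) = fixedSnd H (f k₀) := by
  let tS : TopologicalSpace S := ⊥
  have : DiscreteTopology S := ⟨rfl⟩
  have hc : Continuous fun k => GSpace.prodSnd (f k).val :=
    GSpace.continuous_prodSnd.comp ((GSpace.continuous_fixed_val H (X.prod S)).comp hf)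
  filter_upwards [hc.continuousAt.eventually (p := fun t => t = GSpace.prodSnd (f k₀).val)
    ((isOpen_discrete _).mem_nhds rfl)] with k hk
  exact Fixed.ext hk

variable {A : Type u} [AddCommGroup A]

/-- Extension by zero of the restriction to a subset. -/
def indicatorHom {D : FinGSet PUnit.{u + 1}} (U : Set D) :
    (homCoeff A).obj D →+ (homCoeff A).obj D :=
  AddMonoidHom.mk' (fun κ : D → A => U.indicator κ) fun κ μ => Set.indicator_add U κ μ

/-- The first component of a map to `(X × S)^H`. -/
def fstMaps {D : FinGSet PUnit.{u + 1}} (φ : D.Maps (fixedSpace H (X.prod S))) :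
    D.Maps (fixedSpace H X) :=
  plainMaps fun d => fixedFst H (φ d)

/-- The subset on which the second component of a map to `(X × S)^H` is `s`. -/
def sndFiber {D : FinGSet PUnit.{u + 1}} (φ : D.Maps (fixedSpace H (X.prod S)))
    (s : Fixed H S) : Set D :=
  {d | fixedSnd H (φ d) = s}

/-- The part of an element of `(X × S)^H ⊗_F A` that lies over `s`. -/
def component (X : GSpace G) (A : Type u) [AddCommGroup A] (s : Fixed H S) :
    Tensor (fixedSpace H (X.prod S)) (homCoeff A) →+ Tensor (fixedSpace H X) (homCoeff A) :=
  Tensor.lift (fun _ φ => (Tensor.mkHom (fstMaps H φ)).comp (indicatorHom (sndFiber H φ s)))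
    fun f φ κ => (Tensor.glue f (fstMaps H φ) (indicatorHom (sndFiber H φ s ∘ f) κ)).trans
      (congrArg (Tensor.mk (k := homCoeff A) (fstMaps H φ))
        (transfer_indicator f (sndFiber H φ s) κ))

theorem density_component (s : Fixed H S)
    (y : Tensor (fixedSpace H (X.prod S)) (homCoeff A)) (x : Fixed H X) :
    density (fixedSpace H X) A (component H X A s y) x =
      density (fixedSpace H (X.prod S)) A y (fixedPair H s x) := by
  induction y using Tensor.ind with | h D φ κ
  exact transfer_indicator_apply (eq_fixedPair_iff H) κ

/-- As `S` is discrete and `D` is finite, the subset of `D` lying over `s` is locally constant in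
`φ`. Near `φ₀` the component is thus a class with constant coefficient and continuously varying
points. -/
theorem continuous_component (s : Fixed H S) : Continuous (component H X A s) := by
  refine Tensor.continuous_of_mk fun D κ => continuous_iff_continuousAt.2 fun φ₀ => ?_
  have h1 : Continuous fun φ : D.Maps (fixedSpace H (X.prod S)) =>
      (Tensor.mk (fstMaps H φ) (indicatorHom (sndFiber H φ₀ s) κ) :
        Tensor (fixedSpace H X) (homCoeff A)) :=
    (Tensor.continuous_mk _).comp
      (Maps.continuous_mk fun d => (continuous_fixedFst H).comp
        (Maps.continuous_apply continuous_id d))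
  refine h1.continuousAt.congr ?_
  have h2 : ∀ d : D, ∀ᶠ φ : D.Maps (fixedSpace H (X.prod S)) in nhds φ₀,
      fixedSnd H (φ d) = fixedSnd H (φ₀ d) := fun d =>
    eventually_fixedSnd_eq H (Maps.continuous_apply continuous_id d) φ₀
  filter_upwards [Filter.eventually_all.2 h2] with φ hφ
  have e : sndFiber H φ₀ s = sndFiber H φ s := by
    ext d
    simp only [sndFiber, Set.mem_ofPred_eq, hφ d]
  rw [e]
  rfl

/-- The map `X^H ⊗_F A → (X × S)^H ⊗_F A` at an element of `S^H`. -/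
def cocomponent (X : GSpace G) (A : Type u) [AddCommGroup A] (s : Fixed H S) :
    Tensor (fixedSpace H X) (homCoeff A) →+ Tensor (fixedSpace H (X.prod S)) (homCoeff A) :=
  Tensor.map (GSpace.underlyingMap (X := (GSpace.fixed H).obj X)
    (Y := (GSpace.fixed H).obj (X.prod S)) (fixedPair H s) (continuous_fixedPair H s))
    (homCoeffMap (AddMonoidHom.id A))

/-- The element of `(X × S)^H ⊗_F A` with given components. -/
def assemble (ψ : Fixed H S → Tensor (fixedSpace H X) (homCoeff A)) :
    Tensor (fixedSpace H (X.prod S)) (homCoeff A) :=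
  ∑ s ∈ (Set.finite_univ (α := Fixed H S)).toFinset, cocomponent H X A s (ψ s)

/-- The inclusions `fixedPair H t` for different `t` have disjoint images, so only the summand at
`s` contributes. -/
theorem density_assemble (ψ : Fixed H S → Tensor (fixedSpace H X) (homCoeff A))
    (s : Fixed H S) (x : Fixed H X) :
    density (fixedSpace H (X.prod S)) A (assemble H ψ) (fixedPair H s x) =
      density (fixedSpace H X) A (ψ s) x := by
  rw [assemble, map_sum]
  refine (Finset.sum_apply (fixedPair H s x : Fixed H (X.prod S)) _ _).trans
    ((Finset.sum_eq_single s ?_ ?_).trans ?_)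
  · intro t _ ht
    exact density_map_of_notMem (f := GSpace.underlyingMap (X := (GSpace.fixed H).obj X)
      (Y := (GSpace.fixed H).obj (X.prod S)) (fixedPair H t) (continuous_fixedPair H t))
      (fun x' (h : fixedPair H t x' = fixedPair H s x) => ht (congrArg (fixedSnd H) h))
      (AddMonoidHom.id A) (ψ t)
  · intro h
    simp at h
  · exact density_map_of_injective (f := GSpace.underlyingMap (X := (GSpace.fixed H).obj X)
      (Y := (GSpace.fixed H).obj (X.prod S)) (fixedPair H s) (continuous_fixedPair H s))
      (fixedPair_injective H s) (AddMonoidHom.id A) (ψ s) x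

end Components

/-! ### The isomorphism -/

section Rho

/-- The components of a morphism of topological Mackey functors. -/
abbrev TopMackeyFunctor.app {G : Type u} [Group G] {P Q : TopMackeyFunctor.{u, w} G} (f : P ⟶ Q)
    (S : FinGSet G) : P.obj S →+ Q.obj S :=
  CoeffSystem.Hom.app (MackeyFunctor.Hom.toHom (TopMackeyFunctor.Hom.toMackeyHom f)) S

variable {G : Type u} [Group G] (H : Subgroup G) (X : GSpace G) (A : GModule.{u, u} (Weyl H))

/-- The map `(X × S) ⊗ R A → Map_{WH}(S^H, X^H ⊗_F A)`. -/
def rhoApp (S : FinGSet G) : (tensorObj X (RObj H A)).obj S →+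
    ((RTop H).obj (tensorFObj ((GSpace.fixed H).obj X) A)).obj S :=
  AddMonoidHom.mk' (fun x => (⟨fun s => component H X A s (fixedTensor H (X.prod S) A x),
      -- Equivariance is checked on coefficients. Since `g` acts surjectively on `X^H`, only points
      -- of the form `g • z` need to be considered, and there both sides transform by `g`.
      fun g s => density_injective (funext fun z => by
        obtain ⟨z, rfl⟩ := MulAction.surjective (α := Weyl H) (β := Fixed H X) g z
        refine (density_component H _ _ _).trans ?_
        refine Eq.trans ?_ (density_smul (Y := (GSpace.fixed H).obj X) (A := A) g _ z).symm
        rw [density_component]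
        refine Eq.trans ?_ (fixedDensity_fixedTensor_smul H x g (fixedPair H s z))
        rw [smul_fixedPair])⟩ :
      Fixed H S →[Weyl H] tensorFObj ((GSpace.fixed H).obj X) A))
    fun x y => MulActionHom.ext fun s =>
      (congrArg (component H X A s) (map_add (fixedTensor H (X.prod S) A) x y)).trans
        (map_add (component H X A s) _ _)

variable {X A}

theorem density_rhoApp {S : FinGSet G} (x : Tensor (X.prod S) (RObj H A).toCoeffSystem)
    (s : Fixed H S) (z : Fixed H X) :
    density (fixedSpace H X) A (MulActionHom.toFun (rhoApp H X A S x) s) z =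
      fixedDensity H (fixedTensor H (X.prod S) A x) (fixedPair H s z) :=
  density_component H s _ z

theorem continuous_rhoApp (S : FinGSet G) : Continuous (rhoApp H X A S) := by
  have : CG.{u} ((tensorObj X (RObj H A)).obj S) := KTopAddGroup.cg
  exact continuous_toMap fun s => (continuous_component H s).comp (continuous_fixedTensor H)

theorem fixedDensity_eq_of_fixedPair {S : FinGSet G}
    {y y' : Tensor (fixedSpace H (X.prod S)) (homCoeff A)}
    (h : ∀ (s : Fixed H S) (z : Fixed H X), fixedDensity (Z := X.prod S) H y (fixedPair H s z) =
      fixedDensity (Z := X.prod S) H y' (fixedPair H s z)) : y = y' :=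
  density_injective (funext fun z => h (fixedSnd H z) (fixedFst H z))

/-- The map from `Map_{WH}(S^H, X^H ⊗_F A)` to `(X × S)^H ⊗_F A`. -/
def assembleMaps (S : FinGSet G)
    (ψ : ((RTop H).obj (tensorFObj ((GSpace.fixed H).obj X) A)).obj S) :
    Tensor (fixedSpace H (X.prod S)) (homCoeff A) :=
  assemble H (MulActionHom.toFun ψ)

theorem continuous_assembleMaps (S : FinGSet G) :
    Continuous (assembleMaps H (X := X) (A := A) S) := by
  -- Addition is continuous only for the compactly generated product, so a sum of continuous maps is
  -- known to be continuous when its source is compactly generated.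
  have : CG.{u} (((RTop H).obj (tensorFObj ((GSpace.fixed H).obj X) A)).obj S) :=
    KTopAddGroup.cg
  exact KTopAddGroup.sum_comp.{u} _ fun s => (Tensor.continuous_map _ _).comp
    (continuous_eval (G := Weyl H) (B := tensorFObj ((GSpace.fixed H).obj X) A) s)

theorem assembleMaps_rhoApp (S : FinGSet G) (x : Tensor (X.prod S) (RObj H A).toCoeffSystem) :
    assembleMaps H S (rhoApp H X A S x) = fixedTensor H (X.prod S) A x :=
  fixedDensity_eq_of_fixedPair H fun s z =>
    (density_assemble H _ s z).trans (density_rhoApp H x s z)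

theorem rhoApp_injective (S : FinGSet G) : Function.Injective (rhoApp H X A S) :=
  fun x y h => fixedTensor_injective H ((assembleMaps_rhoApp H S x).symm.trans
    ((congrArg (assembleMaps H S) h).trans (assembleMaps_rhoApp H S y)))

/-- Equivariance of `ψ` turns into equivariance of the coefficients of the assembled element, which
therefore has a preimage under `fixedTensor`. -/
theorem rhoApp_surjective [Finite G] (S : FinGSet G) : Function.Surjective (rhoApp H X A S) := by
  intro ψ
  obtain ⟨x, hx⟩ := exists_fixedTensor_eq H (Z := X.prod S) (A := A) (assembleMaps H S ψ) (by
    intro g z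
    obtain ⟨s, z, rfl⟩ : ∃ s z', z = fixedPair H s z' := ⟨fixedSnd H z, fixedFst H z, rfl⟩
    rw [smul_fixedPair]
    refine (density_assemble H _ _ _).trans (Eq.trans ?_
      (congrArg (g • ·) (density_assemble H _ s z)).symm)
    refine (congrArg (fun y => density (fixedSpace H X) A y (g • z))
      (MulActionHom.map_smul' ψ g s)).trans ?_
    exact density_smul (Y := (GSpace.fixed H).obj X) (A := A) g _ z)
  refine ⟨x, MulActionHom.ext fun s => density_injective (funext fun z => ?_)⟩
  refine (density_rhoApp H x s z).trans ?_
  rw [hx]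
  exact density_assemble H _ s z

/-- The composite of `rhoApp` with the continuous map `assembleMaps` is the closed embedding
`fixedTensor`. Hence `rhoApp` is inducing, and it is bijective. -/
theorem isHomeomorph_rhoApp [Finite G] (S : FinGSet G) : IsHomeomorph (rhoApp H X A S) := by
  have h1 : assembleMaps H S ∘ rhoApp H X A S = fixedTensor H (X.prod S) A :=
    funext (assembleMaps_rhoApp H S)
  have h2 : IsInducing (rhoApp H X A S) :=
    .of_comp (continuous_rhoApp H S) (continuous_assembleMaps H S)
      (h1 ▸ (isClosedEmbedding_fixedTensor H).isInducing)
  let e := Equiv.ofBijective (rhoApp H X A S) ⟨rhoApp_injective H S, rhoApp_surjective H S⟩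
  exact (e.toHomeomorphOfIsInducing h2).isHomeomorph

/-- Pushing forward along `f` changes neither the points in `X^H` nor the coefficient `c`; it only
merges the fibres over `S^H`. Both sides are classes over the same map to `X^H`, and their
coefficients agree. -/
theorem rhoApp_cov {S T : FinGSet G} (f : S →[G] T)
    (x : Tensor (X.prod S) (RObj H A).toCoeffSystem) :
    rhoApp H X A T (tensorCov (RObj H A) f x) =
      RCov H (tensorFObj ((GSpace.fixed H).obj X) A).toGModule f (rhoApp H X A S x) := by
  induction x using Tensor.ind with | h C γ c
  refine MulActionHom.ext fun t => ?_
  let φ := fstMaps H (fixedMaps H γ)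
  refine Eq.trans ?_ (map_transfer (Tensor.mkHom (k := homCoeff A) φ) (fixedMap H f)
    (fun s => indicatorHom (sndFiber H (fixedMaps H γ) s) (RObj.fn H A c)) t)
  exact congrArg (Tensor.mk (k := homCoeff A) φ)
    (indicator_eq_transfer (fun d => fixedSnd H (fixedMap H γ d)) (fixedMap H f) (RObj.fn H A c) t)

/-- On coefficients this is base change for sums over fibres: taking `H`-fixed points turns the
pullback of `γ` along `id × f` into a pullback of sets. -/
theorem rhoApp_contra {S T : FinGSet G} (f : S →[G] T)
    (x : Tensor (X.prod T) (RObj H A).toCoeffSystem) :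
    rhoApp H X A S (tensorContra (RObj H A) f x) =
      RContra H (tensorFObj ((GSpace.fixed H).obj X) A).toGModule f (rhoApp H X A T x) := by
  induction x using Tensor.ind with | h C γ c
  refine MulActionHom.ext fun s => density_injective (funext fun z => ?_)
  refine (density_rhoApp H _ s z).trans (Eq.trans ?_ 
    (density_rhoApp H (A := A) (Tensor.mk γ c) (fixedMap H f s) z).symm)
  refine (transfer_base_change (f := fixedMap H (pullMap (sndMap γ) f γ))
    (g := fixedMap H (pullbackFst (sndMap γ) f)) (k := fixedMap H γ)
    (h := fixedMap H (GSpace.Hom.map (GSpace.prodMap (𝟙 X) f))) ?_ ?_ (RObj.fn H A c)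
    (fixedPair H s z)).symm
  · exact fun p => Fixed.ext (Prod.ext rfl p.val.2.symm)
  · intro b d e
    have h1 : sndMap γ d.val = f (GSpace.prodSnd b.val) :=
      (congrArg (fun y => GSpace.prodSnd (Fixed.val y)) e).symm
    have h2 : GSpace.prodFst (γ d.val) = GSpace.prodFst b.val :=
      (congrArg (fun y => GSpace.prodFst (Fixed.val y)) e).symm
    -- The point of the fibre product determined by `d` and the second component of `b` is fixed by
    -- `H` because both of them are.
    refine ⟨⟨⟨(d.val, GSpace.prodSnd b.val), h1⟩, fun h hh => Subtype.ext (Prod.ext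
      (d.smul_val h hh) (congrArg GSpace.prodSnd (b.smul_val h hh)))⟩,
      ⟨Fixed.ext (Prod.ext h2 rfl), rfl⟩, ?_⟩
    rintro p ⟨rfl, rfl⟩
    rfl

theorem rhoApp_naturality {Y : GSpace G} {B : GModule.{u, u} (Weyl H)} (f : X ⟶ Y) (a : A ⟶ B)
    (S : FinGSet G) (x : Tensor (X.prod S) (RObj H A).toCoeffSystem) :
    rhoApp H Y B S (TopMackeyFunctor.app (tensorMap f ((R H).map a)) S x) =
      TopMackeyFunctor.app ((RTop H).map (tensorFMap ((GSpace.fixed H).map f) a)) S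
        (rhoApp H X A S x) := by
  induction x using Tensor.ind with | h C γ c
  refine MulActionHom.ext fun s => Tensor.mk_congr (k := homCoeff B) (fun _ => rfl) ?_
  funext d
  -- Extension by zero commutes with `a` because `a` preserves zero.
  by_cases hd : d ∈ sndFiber H (fixedMaps H γ) s
  · exact (Set.indicator_of_mem hd _).trans
      (congrArg (DFunLike.coe (F := A →+[Weyl H] B) a) (Set.indicator_of_mem hd _)).symm
  · exact (Set.indicator_of_notMem hd _).trans ((congrArg (DFunLike.coe (F := A →+[Weyl H] B) a)
      (Set.indicator_of_notMem hd _)).trans (map_zero (F := A →+[Weyl H] B) a)).symm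

/-- The morphism `X ⊗ R A → R (X^H ⊗_F A)`. -/
def rhoHom (X : GSpace G) (A : GModule.{u, u} (Weyl H)) :
    tensorObj X (RObj H A) ⟶ (RTop H).obj (tensorFObj ((GSpace.fixed H).obj X) A) where
  app := rhoApp H X A
  app_cov := rhoApp_cov H
  app_contra := rhoApp_contra H
  cont := continuous_rhoApp H

end Rho

/-! ### Isomorphisms and maps out of cokernels of topological Mackey functors -/

section Iso

variable {G : Type u} [Group G] {P Q : TopMackeyFunctor.{u, w} G}

/-- A morphism of topological Mackey functors whose components are homeomorphisms is an
isomorphism. -/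
def TopMackeyFunctor.isoOfIsHomeomorph (f : P ⟶ Q)
    (h : ∀ S, IsHomeomorph (TopMackeyFunctor.app f S)) : P ≅ Q :=
  let e S := AddEquiv.ofBijective (TopMackeyFunctor.app f S) (h S).bijective
  { hom := f
    inv :=
      { app := fun S => (e S).symm.toAddMonoidHom
        app_cov := fun {S T} g x => (e T).injective (by
          refine ((e T).apply_symm_apply _).trans (Eq.trans ?_
            (CoeffSystem.Hom.app_cov f.toHom g ((e S).symm x)).symm)
          exact congrArg (Q.cov g) ((e S).apply_symm_apply x).symm)
        app_contra := fun {S T} g x => (e S).injective (by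
          refine ((e S).apply_symm_apply _).trans (Eq.trans ?_
            (MackeyFunctor.Hom.app_contra f.toMackeyHom g ((e T).symm x)).symm)
          exact congrArg (Q.contra g) ((e T).apply_symm_apply x).symm)
        cont := fun S => ((h S).homeomorph _).symm.continuous }
    hom_inv_id := by
      apply TopMackeyFunctor.Hom.ext
      funext S
      exact AddMonoidHom.ext (e S).symm_apply_apply
    inv_hom_id := by
      apply TopMackeyFunctor.Hom.ext
      funext S
      exact AddMonoidHom.ext (e S).apply_symm_apply }

/-- The morphism out of a cokernel induced by a morphism that vanishes on the image. -/
def TopMackeyFunctor.cokerDesc {T : TopMackeyFunctor.{u, w} G} (f : P ⟶ Q) (g : Q ⟶ T)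
    (h : ∀ S x, TopMackeyFunctor.app g S (TopMackeyFunctor.app f S x) = 0) :
    TopMackeyFunctor.coker f ⟶ T where
  app S := QuotientAddGroup.lift _ (TopMackeyFunctor.app g S) (by
    rintro _ ⟨x, rfl⟩
    exact h S x)
  app_cov {S U} k x := by
    obtain ⟨x, rfl⟩ := TopMackeyFunctor.cokerProj_surjective f S x
    exact CoeffSystem.Hom.app_cov g.toHom k x
  app_contra {S U} k x := by
    obtain ⟨x, rfl⟩ := TopMackeyFunctor.cokerProj_surjective f U x
    exact MackeyFunctor.Hom.app_contra g.toMackeyHom k x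
  cont S := (isQuotientMap_quotient_mk'
    (s := QuotientAddGroup.leftRel (TopMackeyFunctor.app f S).range)).continuous_iff.2
    (TopMackeyFunctor.Hom.cont g S)

end Iso

/-! ### Splitting the cokernel of a map of topological modules -/

section Split

variable {G : Type u} [Group G] {A B : TopGModule.{u, v} G} (f : A ⟶ B) (p : B ⟶ B)

/-- If `p` is the identity on the image of `f`, then `1 - p` is defined on the cokernel of `f`. -/
def TopGModule.cokerSection (h : ∀ x, p.map (f.map x) = f.map x) : TopGModule.coker f ⟶ B where
  map :=
    { toFun := QuotientAddGroup.lift (TopGModule.range f)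
        (AddMonoidHom.id B - p.map.toAddMonoidHom) (by
          rintro _ ⟨x, rfl⟩
          exact sub_eq_zero.2 (h x).symm)
      map_zero' := map_zero (QuotientAddGroup.lift _ _ _)
      map_add' := map_add (QuotientAddGroup.lift _ _ _)
      map_smul' := fun g x => by
        obtain ⟨x, rfl⟩ := TopGModule.cokerProj_surjective f x
        change g • x - p.map (g • x) = g • (x - p.map x)
        rw [map_smul, smul_sub] }
  cont := by
    refine (isQuotientMap_quotient_mk'
      (s := QuotientAddGroup.leftRel (TopGModule.range f))).continuous_iff.2 ?_
    have := KTopAddGroup.cg.{u} (B := B)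
    have h1 : Continuous fun x : B => x + -p.map x :=
      KTopAddGroup.add_comp.{u} continuous_id (KTopAddGroup.neg.{u}.comp p.cont)
    simp only [← sub_eq_add_neg] at h1
    exact h1

/-- Subtracting `p x`, which lies in the image of `f`, does not change the class of `x`. -/
theorem TopGModule.cokerProj_cokerSection (h : ∀ x, p.map (f.map x) = f.map x)
    (h' : ∀ x, p.map x ∈ TopGModule.range f) (x : TopGModule.coker f) :
    (TopGModule.cokerProj f).map ((TopGModule.cokerSection f p h).map x) = x := by
  obtain ⟨x, rfl⟩ := TopGModule.cokerProj_surjective f x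
  change QuotientAddGroup.mk' (TopGModule.range f) (x - p.map x) = _
  rw [map_sub]
  exact (congrArg _ ((QuotientAddGroup.eq_zero_iff _).2 (h' x))).trans (sub_zero _)

end Split

/-! ### The reduced isomorphism -/

section Reduced

variable {G : Type u} [Group G] (H : Subgroup G) (X : BasedGSpace G)
  (A : GModule.{u, u} (Weyl H))

/-- The map from a `G`-space to the one-point space. -/
def GSpace.toPoint (X : GSpace G) : X ⟶ GSpace.point G where
  map := ⟨fun _ => PUnit.unit, fun _ _ => rfl⟩
  cont := continuous_const

/-- The constant map at the base point. -/
abbrev BasedGSpace.const : X.space ⟶ X.space := X.space.toPoint ≫ X.incl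

/-- The inclusion `y₀ ⊗_F A → X^H ⊗_F A`. -/
abbrev fixedIncl := tensorFMap ((BasedGSpace.fixed H).obj X).incl (𝟙 A)

/-- The endomorphism of `X^H ⊗_F A` induced by the constant map. -/
abbrev fixedConst := tensorFMap ((GSpace.fixed H).map X.const) (𝟙 A)

/-- Together with `fixedConst_mem_range` this makes the constant map a continuous projection of `X^H
⊗_F A` onto the image of the base point, as needed for `TopGModule.cokerSection`. -/
theorem fixedConst_fixedIncl
    (y : tensorFObj (GSpace.point (Weyl H)) A) :
    (fixedConst H X A).map ((fixedIncl H X A).map y) = (fixedIncl H X A).map y := by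
  induction y using Tensor.ind with | h D φ κ
  rfl

/-- Two one-point `WH`-spaces occur here, the fixed points of the one-point `G`-space and the
one-point `WH`-space itself. The map from the first to the second relates the images. -/
theorem tensorFMap_mem_range_fixedIncl
    (y : tensorFObj ((GSpace.fixed H).obj (GSpace.point G)) A) :
    (tensorFMap ((GSpace.fixed H).map X.incl) (𝟙 A)).map y ∈
      TopGModule.range (fixedIncl H X A) := by
  refine ⟨(tensorFMap (GSpace.toPoint _) (𝟙 A)).map y, ?_⟩
  induction y using Tensor.ind with | h D φ κ
  rfl

theorem fixedConst_mem_range (y : tensorFObj ((GSpace.fixed H).obj X.space) A) :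
    (fixedConst H X A).map y ∈ TopGModule.range (fixedIncl H X A) := by
  refine ⟨(tensorFMap (GSpace.toPoint _) (𝟙 A)).map y, ?_⟩
  induction y using Tensor.ind with | h D φ κ
  rfl

/-- The morphism `X ⊗ R A → R (X^H ⊗~_F A)`. -/
def rhoProj : tensorObj X.space (RObj H A) ⟶
    (RTop H).obj (TopGModule.coker (fixedIncl H X A)) :=
  rhoHom H X.space A ≫ (RTop H).map (TopGModule.cokerProj (fixedIncl H X A))

/-- By naturality of `rhoApp` for the inclusion of the base point, the values come from the fixed
points of a one-point space, and these die in the cokernel. -/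
theorem rhoProj_incl (S : FinGSet G) (x : (tensorObj (GSpace.point G) (RObj H A)).obj S) :
    TopMackeyFunctor.app (rhoProj H X A) S
      (TopMackeyFunctor.app (tensorMap X.incl (𝟙 (RObj H A))) S x) = 0 := by
  refine MulActionHom.ext fun s => (QuotientAddGroup.eq_zero_iff _).2 ?_
  have h := rhoApp_naturality H X.incl (𝟙 A) S x
  have hs := DFunLike.congr_fun (F := Fixed H S →[Weyl H]
    tensorFObj ((GSpace.fixed H).obj X.space) A) h s
  exact Set.mem_of_eq_of_mem hs (tensorFMap_mem_range_fixedIncl H X A _)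

/-- The morphism `X ⊗~ R A → R (X^H ⊗~_F A)`. -/
def redRhoHom : TopMackeyFunctor.coker (tensorMap X.incl (𝟙 (RObj H A))) ⟶
    (RTop H).obj (TopGModule.coker (fixedIncl H X A)) :=
  TopMackeyFunctor.cokerDesc _ (rhoProj H X A) (rhoProj_incl H X A)

/-- If the image of `x` is zero in the cokernel, every value of `rhoApp` at `x` is fixed by the
constant map. Naturality and injectivity of `rhoApp` then show that `x` itself is fixed by the
constant map, so it comes from the base point. -/
theorem redRhoHom_injective (S : FinGSet G) :
    Function.Injective (TopMackeyFunctor.app (redRhoHom H X A) S) := by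
  rw [injective_iff_map_eq_zero]
  intro x hx
  obtain ⟨x, rfl⟩ := TopMackeyFunctor.cokerProj_surjective _ S x
  refine (QuotientAddGroup.eq_zero_iff _).2 ⟨TopMackeyFunctor.app
    (tensorMap X.space.toPoint (𝟙 (RObj H A))) S x, ?_⟩
  have hs : ∀ s, (fixedConst H X A).map (MulActionHom.toFun (rhoApp H X.space A S x) s) =
      MulActionHom.toFun (rhoApp H X.space A S x) s := by
    intro s
    obtain ⟨y, hy⟩ := (QuotientAddGroup.eq_zero_iff _).1 (DFunLike.congr_fun
      (F := Fixed H S →[Weyl H] TopGModule.coker (fixedIncl H X A)) hx s)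
    exact (congrArg _ hy).symm.trans ((fixedConst_fixedIncl H X A y).trans hy)
  have h := (rhoApp_naturality H X.const (𝟙 A) S x).trans (MulActionHom.ext hs)
  refine Eq.trans ?_ (rhoApp_injective H S h)
  induction x using Tensor.ind with | h C γ c
  rfl

/-- The section of the projection from `X^H ⊗_F A` to its reduced version. -/
def fixedSection : TopGModule.coker (fixedIncl H X A) ⟶
    tensorFObj ((GSpace.fixed H).obj X.space) A :=
  TopGModule.cokerSection (fixedIncl H X A) (fixedConst H X A) (fixedConst_fixedIncl H X A)

/-- Applying `RTop` to a quotient map does not obviously give a quotient map, but the continuous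
section avoids this question: lift to `X^H ⊗_F A`, apply the inverse of `rhoApp` and project. The
result is a continuous right inverse of an injective map, hence a two-sided inverse. -/
theorem isHomeomorph_redRhoHom [Finite G] (S : FinGSet G) :
    IsHomeomorph (TopMackeyFunctor.app (redRhoHom H X A) S) := by
  let e := (isHomeomorph_rhoApp H (X := X.space) (A := A) S).homeomorph
  let σ := TopMackeyFunctor.app ((RTop H).map (fixedSection H X A)) S
  let g := fun ψ => TopMackeyFunctor.app (TopMackeyFunctor.cokerProj
    (tensorMap X.incl (𝟙 (RObj H A)))) S (e.symm (σ ψ))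
  have hg : Function.RightInverse g (TopMackeyFunctor.app (redRhoHom H X A) S) := by
    intro ψ
    refine (congrArg (TopMackeyFunctor.app ((RTop H).map (TopGModule.cokerProj
      (fixedIncl H X A))) S) (e.apply_symm_apply (σ ψ))).trans (MulActionHom.ext fun s => ?_)
    exact TopGModule.cokerProj_cokerSection _ _ (fixedConst_fixedIncl H X A)
      (fixedConst_mem_range H X A) _
  have hgc : Continuous g := (TopMackeyFunctor.Hom.cont (TopMackeyFunctor.cokerProj
    (tensorMap X.incl (𝟙 (RObj H A)))) S).comp (e.symm.continuous.comp
    (TopMackeyFunctor.Hom.cont ((RTop H).map (fixedSection H X A)) S))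
  exact Homeomorph.isHomeomorph
    { toFun := TopMackeyFunctor.app (redRhoHom H X A) S
      invFun := g
      left_inv := hg.leftInverse_of_injective (redRhoHom_injective H X A S)
      right_inv := hg
      continuous_toFun := TopMackeyFunctor.Hom.cont (redRhoHom H X A) S
      continuous_invFun := hgc }

end Reduced

end

end MackeyTensor

/-! ### The natural isomorphisms and their compatibility -/

open MackeyTensor

theorem mainTheorem5 (G : Type u) [Group G] [Finite G] (H : Subgroup G) :
    ∃ (ϱ : (𝟭 (GSpace G)).prod (R.{u, u} H) ⋙ tensor G ≅
        (GSpace.fixed H).prod (𝟭 (GModule.{u, u} (Weyl H))) ⋙ tensorF (Weyl H) ⋙ RTop H)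
      (ϱ' : (𝟭 (BasedGSpace G)).prod (R.{u, u} H) ⋙ redTensor G ≅
        (BasedGSpace.fixed H).prod (𝟭 (GModule.{u, u} (Weyl H))) ⋙ redTensorF (Weyl H) ⋙ RTop H),
      ∀ (X : BasedGSpace G) (A : GModule.{u, u} (Weyl H)),
        (tensorProj G).app (X, (R H).obj A) ≫ ϱ'.hom.app (X, A) =
          ϱ.hom.app (X.space, A) ≫
            (RTop H).map ((tensorFProj (Weyl H)).app ((BasedGSpace.fixed H).obj X, A)) := by
  refine ⟨NatIso.ofComponents (fun P => TopMackeyFunctor.isoOfIsHomeomorph (rhoHom H P.1 P.2)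
      (isHomeomorph_rhoApp H)) fun {P Q} F => ?_,
    NatIso.ofComponents (fun P => TopMackeyFunctor.isoOfIsHomeomorph (redRhoHom H P.1 P.2)
      (isHomeomorph_redRhoHom H P.1 P.2)) fun {P Q} F => ?_, fun X A => ?_⟩
  · apply TopMackeyFunctor.Hom.ext
    funext S
    exact AddMonoidHom.ext (rhoApp_naturality H F.1 F.2 S)
  · apply TopMackeyFunctor.Hom.ext
    funext S
    refine AddMonoidHom.ext fun x => ?_
    -- Elements of the cokernel lift to the unreduced tensor product, so naturality of the reduced
    -- map follows from that of `rhoApp`.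
    obtain ⟨x, rfl⟩ := TopMackeyFunctor.cokerProj_surjective _ S x
    exact congrArg (TopMackeyFunctor.app ((RTop H).map (TopGModule.cokerProj
      (fixedIncl H Q.1 Q.2))) S) (rhoApp_naturality H (BasedGSpace.Hom.map F.1) F.2 S x)
  -- The reduced morphism was obtained by descending the unreduced one followed by the projection,
  -- so the compatibility is definitional.
  · rfl
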